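/- Let $k$ be a field and let $Q=(Q_0,Q_1,s,t)$ be a finite quiver without oriented cycles whose underlying graph is one of the Euclidean diagrams $\tilde A_m$ ($m\ge 0$), $\tilde D_m$ ($m\ge 4$), $\tilde E_6,\tilde E_7,\tilde E_8$, with $n$ vertices. For $x,y\in\mathbb Z^{Q_0}$ let $\langle x,y\rangle=\sum_{i\in Q_0}x_iy_i-\sum_{\alpha\in Q_1}x_{s(\alpha)}y_{t(\alpha)}$ be the Euler form and $q(x)=\langle x,x\rangle$. A root is a non-zero $x\in\mathbb Z^{Q_0}$ with $q(x)\le 1$; it is positive if $x_i\ge 0$ for all $i$. Let $\delta\in\mathbb Z^{Q_0}$ be the standard positive generator of the radical of $q$, that is, the vector of the usual marks on the Euclidean diagram, and let $\partial x=\langle\delta,x\rangle$ be the defect of $x$. For a vertex $i$ let $P(i)$ and $I(i)$ be the representations of $Q$ over $k$ with $P(i)_j=k[Q(i,j)]$ and $I(i)_j=\operatorname{Hom}_k(k[Q(j,i)],k)$, where $Q(a,b)$ is the set of paths from $a$ to $b$ and $k[S]$ is the vector space with basis $S$; arrows act by composition of paths. An ordering $i_1,\dots,i_n$ of $Q_0$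 is admissible if, for each $p$, the vertex $i_p$ is a sink of $\sigma_{i_{p-1}}\cdots\sigma_{i_1}Q$, where $\sigma_i$ reverses all arrows at $i$; such orderings exist. Fix one, and let $C^+=S^+_{i_n}\cdots S^+_{i_1}$ and $C^-=S^-_{i_1}\cdots S^-_{i_n}$ be the Coxeter functors, where $S_i^{+}$ (for a sink $i$) and $S_i^-$ (for a source $i$) are the Bernstein--Gelfand--Ponomarev reflection functors. Put $C^r=(C^+)^r$ and $C^{-r}=(C^-)^{r}$ for $r\ge 0$. An indecomposable representation $X$ of $Q$ is called preprojective if $X\cong C^{-r}P(i)$, and preinjective if $X\cong C^{r}I(i)$, for some $i\in Q_0$ and some integer $r\ge 0$. Then the following hold. 1. The assignment $X\mapsto\dim X=(\dim_k X_i)_{i\in Q_0}$ induces a bijection between the isomorphism classes of (finite dimensional) indecomposable representations of $Q$ that are preprojective or preinjective and the positive roots $x$ with $\partial x\neq 0$. 2. The indecomposable preprojective and preinjective representations form $2n$ countably infinite series $C^{-r}P(i)$ and $C^rI(i)$ ($r\in\mathbb N_0$, $i\in Q_0$): all these representations are finite dimensional and indecomposable, they are pairwise non-isomorphic, and every indecomposable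 preprojective or preinjective representation is isomorphic to one of them. -/

import Mathlib

universe u

/-- A quiver `(Q₀, Q₁, s, t)` with set of vertices `V` and set of arrows `E`; both are
assumed finite where this matters. -/
@[ext]
structure FinQuiver (V E : Type) where
  src : E → V
  tgt : E → V

namespace FinQuiver

variable {V E : Type}

/-- The arrows `a ⟶ b`, as a quiver in the sense of Mathlib. -/
@[reducible]
def toQuiver (Q : FinQuiver V E) : Quiver V where
  Hom a b := {e : E // Q.src e = a ∧ Q.tgt e = b}

/-- The set `Q(a, b)` of paths from `a` to `b`, including the trivial path if `a = b`. -/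
abbrev Path (Q : FinQuiver V E) (a b : V) : Type := @Quiver.Path V Q.toQuiver a b

/-- The path `e ξ` obtained by prolonging a path `ξ` that ends at the source of `e`. -/
def Path.snoc (Q : FinQuiver V E) {a : V} (e : E) (p : Q.Path a (Q.src e)) :
    Q.Path a (Q.tgt e) :=
  @Quiver.Path.cons V Q.toQuiver a (Q.src e) (Q.tgt e) p ⟨e, rfl, rfl⟩

/-- The path `ξ e` obtained by preceding a path `ξ` that starts at the target of `e`. -/
def Path.precede (Q : FinQuiver V E) {b : V} (e : E) (p : Q.Path (Q.tgt e) b) :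
    Q.Path (Q.src e) b :=
  @Quiver.Path.comp V Q.toQuiver (Q.src e) (Q.tgt e) b
    (@Quiver.Hom.toPath V Q.toQuiver (Q.src e) (Q.tgt e) ⟨e, rfl, rfl⟩) p

/-- There are no oriented cycles: every path from a vertex to itself is trivial. -/
def NoOrientedCycles (Q : FinQuiver V E) : Prop :=
  ∀ (a : V) (p : Q.Path a a), p = @Quiver.Path.nil V Q.toQuiver a

/-- No arrow starts at `i`. -/
def IsSink (Q : FinQuiver V E) (i : V) : Prop := ∀ e, Q.src e ≠ i

/-- The quiver `σ_i Q`: all arrows which start or end at `i` are reversed. -/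
def reflect [DecidableEq V] (Q : FinQuiver V E) (i : V) : FinQuiver V E where
  src e := if Q.src e = i ∨ Q.tgt e = i then Q.tgt e else Q.src e
  tgt e := if Q.src e = i ∨ Q.tgt e = i then Q.src e else Q.tgt e

/-- `reflectList Q [i₁, …, i_p] = σ_{i_p} ⋯ σ_{i₁} Q`. -/
def reflectList [DecidableEq V] (Q : FinQuiver V E) : List V → FinQuiver V E
  | [] => Q
  | i :: l => reflectList (Q.reflect i) l

/-- For each `p`, the vertex `i_p` is a sink of `σ_{i_{p-1}} ⋯ σ_{i₁} Q`. -/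
def SinkSequence [DecidableEq V] (Q : FinQuiver V E) : List V → Prop
  | [] => True
  | i :: l => Q.IsSink i ∧ SinkSequence (Q.reflect i) l

/-- An admissible ordering of the vertices of `Q`. -/
structure AdmissibleOrdering [DecidableEq V] (Q : FinQuiver V E) where
  list : List V
  nodup : list.Nodup
  mem : ∀ v, v ∈ list
  sinks : Q.SinkSequence list

theorem reflectList_ends [DecidableEq V] (Q : FinQuiver V E) (l : List V) (e : E) :
    ((Q.reflectList l).src e =
      if Even (l.count (Q.src e) + l.count (Q.tgt e)) then Q.src e else Q.tgt e) ∧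
    ((Q.reflectList l).tgt e =
      if Even (l.count (Q.src e) + l.count (Q.tgt e)) then Q.tgt e else Q.src e) := by
  induction l generalizing Q with
  | nil => simp [reflectList]
  | cons i l ih =>
    obtain ⟨h1, h2⟩ := ih (Q.reflect i)
    simp only [reflectList]
    rw [h1, h2]
    by_cases hs : Q.src e = i <;> by_cases ht : Q.tgt e = i
    · simp [reflect, hs, ht]
    · have ht' : ¬ i = Q.tgt e := fun h => ht h.symm
      have hc : Even ((i :: l).count i + (i :: l).count (Q.tgt e)) ↔
          ¬ Even (l.count (Q.tgt e) + l.count i) := by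
        rw [List.count_cons_self, List.count_cons_of_ne ht', add_right_comm,
          Nat.even_add_one, add_comm]
      simp only [reflect, hs, ht, or_false, if_true, hc]
      split_ifs <;> simp_all
    · have hs' : ¬ i = Q.src e := fun h => hs h.symm
      have hc : Even ((i :: l).count (Q.src e) + (i :: l).count i) ↔
          ¬ Even (l.count i + l.count (Q.src e)) := by
        rw [List.count_cons_self, List.count_cons_of_ne hs', ← add_assoc,
          Nat.even_add_one, add_comm]
      simp only [reflect, hs, ht, or_true, if_true, hc]
      split_ifs <;> simp_all
    · have ht' : ¬ i = Q.tgt e := fun h => ht h.symm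
      have hs' : ¬ i = Q.src e := fun h => hs h.symm
      simp [reflect, hs, ht, List.count_cons_of_ne hs', List.count_cons_of_ne ht']

/-- Reflecting once at every vertex reverses every arrow twice. -/
theorem reflectList_eq_self [DecidableEq V] (Q : FinQuiver V E) (l : List V)
    (hl : l.Nodup) (hm : ∀ v, v ∈ l) : Q.reflectList l = Q := by
  have h : ∀ e, Even (l.count (Q.src e) + l.count (Q.tgt e)) := fun e => by
    rw [List.count_eq_one_of_mem hl (hm _), List.count_eq_one_of_mem hl (hm _)]
    decide
  ext e
  · rw [(Q.reflectList_ends l e).1, if_pos (h e)]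
  · rw [(Q.reflectList_ends l e).2, if_pos (h e)]

/-- The Euler form `⟨x, y⟩`. -/
def eulerForm [Fintype V] [Fintype E] (Q : FinQuiver V E) (x y : V → ℤ) : ℤ :=
  ∑ i, x i * y i - ∑ e, x (Q.src e) * y (Q.tgt e)

/-- The quadratic form `q(x) = ½ (x, x) = ⟨x, x⟩` of the underlying graph. -/
def quadForm [Fintype V] [Fintype E] (Q : FinQuiver V E) (x : V → ℤ) : ℤ :=
  Q.eulerForm x x

/-- Roots: the non-zero integral vectors `x` with `q(x) ≤ 1`. -/
def IsRoot [Fintype V] [Fintype E] (Q : FinQuiver V E) (x : V → ℤ) : Prop :=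
  x ≠ 0 ∧ Q.quadForm x ≤ 1

end FinQuiver

/-- The Euclidean diagrams `Ã_m` (`m ≥ 0`), `D̃_m` (`m ≥ 4`), `Ẽ₆`, `Ẽ₇`, `Ẽ₈`. -/
inductive EuclideanDiagram : Type
  | A (m : ℕ) : EuclideanDiagram
  | D (m : ℕ) (hm : 4 ≤ m) : EuclideanDiagram
  | E6 : EuclideanDiagram
  | E7 : EuclideanDiagram
  | E8 : EuclideanDiagram

namespace EuclideanDiagram

/-- The number `n = m + 1` of vertices; the vertices are `0, …, n - 1`. -/
def card : EuclideanDiagram → ℕ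
  | A m => m + 1
  | D m _ => m + 1
  | E6 => 7
  | E7 => 8
  | E8 => 9

/-- The edges. `Ã_m` is a cycle with `m + 1` edges (a loop for `m = 0`, a double edge for
`m = 1`). `D̃_m` is the path `1, …, m - 1` with `0` attached to `2` and `m` attached to
`m - 2`. -/
def edges : EuclideanDiagram → List (ℕ × ℕ)
  | A m => (List.range (m + 1)).map fun i => (i, (i + 1) % (m + 1))
  | D m _ => (0, 2) :: (m - 2, m) :: (List.range (m - 2)).map fun i => (i + 1, i + 2)
  | E6 => [(0, 1), (1, 2), (2, 3), (3, 4), (2, 5), (5, 6)]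
  | E7 => [(0, 1), (1, 2), (2, 3), (3, 4), (4, 5), (5, 6), (3, 7)]
  | E8 => [(0, 1), (1, 2), (2, 3), (3, 4), (4, 5), (5, 6), (6, 7), (2, 8)]

/-- The marks `δ_i` of the vertices. -/
def delta : EuclideanDiagram → ℕ → ℤ
  | A _, _ => 1
  | D m _, v => if v = 0 ∨ v = 1 ∨ v = m - 1 ∨ v = m then 1 else 2
  | E6, v => [1, 2, 3, 2, 1, 2, 1].getD v 0
  | E7, v => [1, 2, 3, 4, 3, 2, 1, 2].getD v 0
  | E8, v => [2, 4, 6, 5, 4, 3, 2, 1, 3].getD v 0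

end EuclideanDiagram

namespace FinQuiver

variable {V E : Type}

/-- The bijection `f` of vertices identifies the underlying graph of `Q`, with its edges
counted with multiplicity, with the Euclidean diagram `T`. -/
def HasDiagram [Fintype E] (Q : FinQuiver V E) (T : EuclideanDiagram)
    (f : V ≃ Fin T.card) : Prop :=
  (Finset.univ : Finset E).val.map (fun e => s((f (Q.src e) : ℕ), (f (Q.tgt e) : ℕ))) =
    ((T.edges.map fun p => s(p.1, p.2) : List (Sym2 ℕ)) : Multiset (Sym2 ℕ))

/-- The defect `∂x = ⟨δ, x⟩`, where `δ` is transported to the vertices of `Q` along `f`. -/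
def defect [Fintype V] [Fintype E] (Q : FinQuiver V E) (T : EuclideanDiagram)
    (f : V ≃ Fin T.card) (x : V → ℤ) : ℤ :=
  Q.eulerForm (fun i => T.delta (f i : ℕ)) x

end FinQuiver

/-- The type `B` if the proposition `P` holds, and `A` otherwise. -/
def Pick {P : Prop} (d : Decidable P) (B A : Type u) : Type u :=
  match d with
  | isTrue _ => B
  | isFalse _ => A

namespace Pick

variable {P : Prop} (d : Decidable P) (B A : Type u)

instance addCommGroup [AddCommGroup B] [AddCommGroup A] : AddCommGroup (Pick d B A) :=
  match d with
  | isTrue _ => inferInstanceAs (AddCommGroup B)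
  | isFalse _ => inferInstanceAs (AddCommGroup A)

variable (k : Type u) [Field k]

instance module [AddCommGroup B] [AddCommGroup A] [Module k B] [Module k A] :
    Module k (Pick d B A) :=
  match d with
  | isTrue _ => inferInstanceAs (Module k B)
  | isFalse _ => inferInstanceAs (Module k A)

variable {B A} [AddCommGroup B] [AddCommGroup A] [Module k B] [Module k A]

/-- The identity, if `P` holds. -/
def posEquiv (h : P) : Pick d B A ≃ₗ[k] B :=
  match d with
  | isTrue _ => LinearEquiv.refl k B
  | isFalse h' => absurd h h'

/-- The identity, if `P` does not hold. -/
def negEquiv (h : ¬ P) : Pick d B A ≃ₗ[k] A :=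
  match d with
  | isTrue h' => absurd h' h
  | isFalse _ => LinearEquiv.refl k A

end Pick

/-- A representation over `k` of the quiver `Q` (not necessarily finite dimensional). -/
structure QuiverRep {V E : Type} (k : Type u) [Field k] (Q : FinQuiver V E) where
  obj : V → Type u
  [addCommGroup : ∀ i, AddCommGroup (obj i)]
  [module : ∀ i, Module k (obj i)]
  map : ∀ e, obj (Q.src e) →ₗ[k] obj (Q.tgt e)

attribute [instance] QuiverRep.addCommGroup QuiverRep.module

namespace QuiverRep

variable {V E : Type} {k : Type u} [Field k] {Q : FinQuiver V E}

/-- Isomorphisms of representations. -/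
structure Iso (X Y : QuiverRep k Q) where
  equiv : ∀ i, X.obj i ≃ₗ[k] Y.obj i
  comm : ∀ e x, Y.map e (equiv (Q.src e) x) = equiv (Q.tgt e) (X.map e x)

/-- `X ≅ Y`. -/
def IsIsomorphic (X Y : QuiverRep k Q) : Prop := Nonempty (Iso X Y)

theorem isIsomorphic_equivalence :
    Equivalence (IsIsomorphic : QuiverRep k Q → QuiverRep k Q → Prop) where
  refl X := ⟨⟨fun i => LinearEquiv.refl k (X.obj i), fun _ _ => rfl⟩⟩
  symm := by
    rintro X Y ⟨f⟩
    refine ⟨⟨fun i => (f.equiv i).symm, fun e y => ?_⟩⟩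
    rw [LinearEquiv.eq_symm_apply, ← f.comm, LinearEquiv.apply_symm_apply]
  trans := by
    rintro X Y Z ⟨f⟩ ⟨g⟩
    refine ⟨⟨fun i => (f.equiv i).trans (g.equiv i), fun e x => ?_⟩⟩
    simp only [LinearEquiv.trans_apply, g.comm, f.comm]

variable (k Q) in
/-- Representations up to isomorphism. -/
def isoSetoid : Setoid (QuiverRep k Q) := ⟨IsIsomorphic, isIsomorphic_equivalence⟩

variable (k Q) in
/-- Isomorphism classes of representations. -/
def IsoClass : Type (u + 1) := Quotient (isoSetoid k Q)

/-- The isomorphism class of a representation. -/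
def isoClass (X : QuiverRep k Q) : IsoClass k Q := Quotient.mk (isoSetoid k Q) X

/-- Each of the vector spaces `X_i` is finite dimensional. -/
def IsFiniteDimensional (X : QuiverRep k Q) : Prop := ∀ i, FiniteDimensional k (X.obj i)

/-- The dimension vector (meaningful for finite dimensional representations). -/
noncomputable def dimVector (X : QuiverRep k Q) : V → ℤ :=
  fun i => (Module.finrank k (X.obj i) : ℤ)

/-- The dimension vector of an isomorphism class. -/
noncomputable def IsoClass.dimVector : IsoClass k Q → V → ℤ :=
  Quotient.lift QuiverRep.dimVector (by
    rintro X Y ⟨f⟩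
    funext i
    exact congrArg Nat.cast (f.equiv i).finrank_eq)

/-- A family of subspaces `U_i` of `X_i` is a subrepresentation of `X`. -/
def IsSubrep (X : QuiverRep k Q) (U : ∀ i, Submodule k (X.obj i)) : Prop :=
  ∀ e, ∀ x ∈ U (Q.src e), X.map e x ∈ U (Q.tgt e)

/-- `X ≠ 0`, and `X = U ⊕ W` implies `U = 0` or `W = 0`. -/
def Indecomposable (X : QuiverRep k Q) : Prop :=
  (∃ i, Nontrivial (X.obj i)) ∧
    ∀ U W : ∀ i, Submodule k (X.obj i), X.IsSubrep U → X.IsSubrep W →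
      (∀ i, IsCompl (U i) (W i)) → (∀ i, U i = ⊥) ∨ (∀ i, W i = ⊥)

variable (k Q) in
/-- The projective representation `P(i)`, with `P(i)_j = k[Q(i, j)]`. -/
noncomputable def proj (i : V) : QuiverRep k Q where
  obj j := Q.Path i j →₀ k
  map e := Finsupp.lmapDomain k k (FinQuiver.Path.snoc Q e)

variable (k Q) in
/-- The injective representation `I(i)`, with `I(i)_j = D k[Q(j, i)]`. -/
noncomputable def inj (i : V) : QuiverRep k Q where
  obj j := Module.Dual k (Q.Path j i →₀ k)
  map e := (Finsupp.lmapDomain k k (FinQuiver.Path.precede Q (b := i) e)).dualMap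

/-- The identity of `X_i`, for two names `i`, `j` of the same vertex. -/
def castObj (X : QuiverRep k Q) {i j : V} (h : i = j) : X.obj i ≃ₗ[k] X.obj j :=
  h ▸ LinearEquiv.refl k (X.obj i)

/-- The map `⨁_{t(α) = i} X_{s(α)} ⟶ X_i` given by the `X_α`. -/
def inMap [DecidableEq V] [Fintype E] (X : QuiverRep k Q) (i : V) :
    ((e : {e : E // Q.tgt e = i}) → X.obj (Q.src e)) →ₗ[k] X.obj i :=
  ∑ e : {e : E // Q.tgt e = i},
    (X.castObj e.2).toLinearMap ∘ₗ X.map e ∘ₗ LinearMap.proj e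

/-- The map `X_i ⟶ ⨁_{s(α) = i} X_{t(α)}` given by the `X_α`. -/
def outMap (X : QuiverRep k Q) (i : V) :
    X.obj i →ₗ[k] ((e : {e : E // Q.src e = i}) → X.obj (Q.tgt e)) :=
  LinearMap.pi fun e => X.map e ∘ₗ (X.castObj e.2.symm).toLinearMap

/-- The underlying spaces of `S_i^+ X`: the kernel of `inMap` at `i`, and `X_j` for
`j ≠ i`. -/
abbrev plusObj [DecidableEq V] [Fintype E] (X : QuiverRep k Q) (i j : V) : Type u :=
  Pick (decEq j i) (LinearMap.ker (X.inMap i)) (X.obj j)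

/-- The representation `S_i^+ X` of `σ_i Q`, for a sink `i` of `Q`. An arrow `α` with
`t(α) = i` acts by the inclusion of the kernel followed by the projection onto `X_{s(α)}`;
the other arrows act as on `X`. (For arrows starting at `i`, which do not exist if `i` is
a sink, the map is set to be `0`.) -/
def reflPlus [DecidableEq V] [Fintype E] (X : QuiverRep k Q) (i : V) :
    QuiverRep k (Q.reflect i) where
  obj j := X.plusObj i j
  map e :=
    if hs : Q.src e = i then 0
    else if ht : Q.tgt e = i then
      have h1 : (Q.reflect i).src e = i := by simp [FinQuiver.reflect, ht]
      have h2 : (Q.reflect i).tgt e = Q.src e := by simp [FinQuiver.reflect, ht]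
      (Pick.negEquiv _ k (h2.trans_ne hs)).symm.toLinearMap ∘ₗ
        (X.castObj h2.symm).toLinearMap ∘ₗ
        LinearMap.proj (⟨e, ht⟩ : {e : E // Q.tgt e = i}) ∘ₗ
        (LinearMap.ker (X.inMap i)).subtype ∘ₗ
        (Pick.posEquiv _ k h1).toLinearMap
    else
      have h1 : (Q.reflect i).src e = Q.src e := by simp [FinQuiver.reflect, hs, ht]
      have h2 : (Q.reflect i).tgt e = Q.tgt e := by simp [FinQuiver.reflect, hs, ht]
      (Pick.negEquiv _ k (h2.trans_ne ht)).symm.toLinearMap ∘ₗ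
        (X.castObj h2.symm).toLinearMap ∘ₗ X.map e ∘ₗ (X.castObj h1).toLinearMap ∘ₗ
        (Pick.negEquiv _ k (h1.trans_ne hs)).toLinearMap

/-- The underlying spaces of `S_i^- X`: the cokernel of `outMap` at `i`, and `X_j` for
`j ≠ i`. -/
abbrev minusObj [DecidableEq V] (X : QuiverRep k Q) (i j : V) : Type u :=
  Pick (decEq j i)
    (((e : {e : E // Q.src e = i}) → X.obj (Q.tgt e)) ⧸ LinearMap.range (X.outMap i))
    (X.obj j)

/-- The representation `S_i^- X` of `σ_i Q`, for a source `i` of `Q`. An arrow `α` with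
`s(α) = i` acts by the inclusion of `X_{t(α)}` into the direct sum followed by the canonical
map onto the cokernel; the other arrows act as on `X`. (For arrows ending at `i`, which do
not exist if `i` is a source, the map is set to be `0`.) -/
def reflMinus [DecidableEq V] [DecidableEq E] (X : QuiverRep k Q) (i : V) :
    QuiverRep k (Q.reflect i) where
  obj j := X.minusObj i j
  map e :=
    if ht : Q.tgt e = i then 0
    else if hs : Q.src e = i then
      have h1 : (Q.reflect i).src e = Q.tgt e := by simp [FinQuiver.reflect, hs]
      have h2 : (Q.reflect i).tgt e = i := by simp [FinQuiver.reflect, hs]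
      (Pick.posEquiv _ k h2).symm.toLinearMap ∘ₗ
        (LinearMap.range (X.outMap i)).mkQ ∘ₗ
        LinearMap.single k (fun e : {e : E // Q.src e = i} => X.obj (Q.tgt e)) ⟨e, hs⟩ ∘ₗ
        (X.castObj h1).toLinearMap ∘ₗ
        (Pick.negEquiv _ k (h1.trans_ne ht)).toLinearMap
    else
      have h1 : (Q.reflect i).src e = Q.src e := by simp [FinQuiver.reflect, hs, ht]
      have h2 : (Q.reflect i).tgt e = Q.tgt e := by simp [FinQuiver.reflect, hs, ht]
      (Pick.negEquiv _ k (h2.trans_ne ht)).symm.toLinearMap ∘ₗ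
        (X.castObj h2.symm).toLinearMap ∘ₗ X.map e ∘ₗ (X.castObj h1).toLinearMap ∘ₗ
        (Pick.negEquiv _ k (h1.trans_ne hs)).toLinearMap

variable [DecidableEq V] [Fintype E] [DecidableEq E]

/-- `S_{i_p}^+ ⋯ S_{i₁}^+ X` for the list `[i₁, …, i_p]`. -/
def plusList {Q : FinQuiver V E} (X : QuiverRep k Q) :
    (l : List V) → QuiverRep k (Q.reflectList l)
  | [] => X
  | i :: l => plusList (X.reflPlus i) l

/-- `S_{i_p}^- ⋯ S_{i₁}^- X` for the list `[i₁, …, i_p]`. -/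
def minusList {Q : FinQuiver V E} (X : QuiverRep k Q) :
    (l : List V) → QuiverRep k (Q.reflectList l)
  | [] => X
  | i :: l => minusList (X.reflMinus i) l

/-- A representation of `Q`, regarded as a representation of the equal quiver `Q'`. -/
def castQuiver {Q Q' : FinQuiver V E} (h : Q = Q') (X : QuiverRep k Q) : QuiverRep k Q' :=
  h ▸ X

/-- The Coxeter functor `C^+ = S_{i_n}^+ ⋯ S_{i₁}^+` on objects. -/
def coxPlus (o : Q.AdmissibleOrdering) (X : QuiverRep k Q) : QuiverRep k Q :=
  castQuiver (Q.reflectList_eq_self o.list o.nodup o.mem) (X.plusList o.list)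

/-- The Coxeter functor `C^- = S_{i₁}^- ⋯ S_{i_n}^-` on objects. -/
def coxMinus (o : Q.AdmissibleOrdering) (X : QuiverRep k Q) : QuiverRep k Q :=
  castQuiver
    (Q.reflectList_eq_self o.list.reverse (List.nodup_reverse.2 o.nodup)
      fun v => List.mem_reverse.2 (o.mem v))
    (X.minusList o.list.reverse)

/-- `C^r X` for an integer `r`: this is `(C^+)^r X` for `r ≥ 0` and `(C^-)^{-r} X` for
`r < 0`. -/
def coxPow (o : Q.AdmissibleOrdering) : ℤ → QuiverRep k Q → QuiverRep k Q
  | Int.ofNat r, X => (coxPlus o)^[r] X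
  | Int.negSucc r, X => (coxMinus o)^[r + 1] X

/-- `X` is indecomposable and `X ≅ C^r P(i)` for some vertex `i` and some `r ≤ 0`. -/
def IsPreprojective (o : Q.AdmissibleOrdering) (X : QuiverRep k Q) : Prop :=
  X.Indecomposable ∧ ∃ (i : V) (r : ℤ), r ≤ 0 ∧ X.IsIsomorphic (coxPow o r (proj k Q i))

/-- `X` is indecomposable and `X ≅ C^r I(i)` for some vertex `i` and some `r ≥ 0`. -/
def IsPreinjective (o : Q.AdmissibleOrdering) (X : QuiverRep k Q) : Prop :=
  X.Indecomposable ∧ ∃ (i : V) (r : ℤ), 0 ≤ r ∧ X.IsIsomorphic (coxPow o r (inj k Q i))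

variable (k) in
/-- The isomorphism classes of finite dimensional indecomposable representations which are
preprojective or preinjective. -/
def preprojPreinjClasses (o : Q.AdmissibleOrdering) : Set (IsoClass k Q) :=
  {c | ∃ X : QuiverRep k Q, X.isoClass = c ∧ X.IsFiniteDimensional ∧
    (IsPreprojective o X ∨ IsPreinjective o X)}

variable (k) in
/-- The series `C^{-r} P(i)` (`r ≥ 0`) for each `i` in the left copy of the set of vertices
and `C^r I(i)` (`r ≥ 0`) for each `i` in the right copy. -/
noncomputable def series (o : Q.AdmissibleOrdering) : V ⊕ V → ℕ → QuiverRep k Q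
  | Sum.inl i, r => coxPow o (-(r : ℤ)) (proj k Q i)
  | Sum.inr i, r => coxPow o (r : ℤ) (inj k Q i)

end QuiverRep

/-! Let `c` be the product of the simple reflections `s_i` along the admissible ordering, and let
`p_i`, `h_i` be the dimension vectors of `P(i)`, `I(i)`. A reflection functor at a sink or source
`i` sends a finite dimensional indecomposable `X` with `dim X ≠ e_i` to an indecomposable of
dimension vector `s_i (dim X)` (`Indecomposable.reflPlus`, `Indecomposable.reflMinus` and the two
lemmas on `dimVector`). Hence `C^+` acts by `c` on the dimension vector `x` of such an `X` unless
the successive reflections meet a simple root at its own vertex. Reflections at sinks are isometries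
between the Euler forms, so in that case `⟨x, y⟩ = y_i` for all `y`, that is, `x = p_i`
(`CoxeterDatum.eq_p_of_not_avoidsSimple`). What remains concerns the action of `c` on vectors.

The defect is invariant under `c`; it is `-δ_i` on `p_i` and `δ_i` on `h_i`. So the orbit `c^r h_i`
is never obstructed and consists of positive roots. Its members are distinct for different `(i, r)`:
since `c p_i = -h_i`, a coincidence with different exponents would make some `-p_i` positive
(`CoxeterDatum.iterate_h_inj`). The preprojective half follows by passing to the opposite quiver
with the reversed ordering, which exchanges `p` with `h` and `c` with its inverse.

Conversely, let `x` be a positive root of negative defect. If its forward orbit never met a `p_i`,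
all `c^r x` would be positive. Modulo `δ` there are only finitely many such vectors, so up to a
positive multiple the orbit is periodic up to adding `t δ`, and positivity forces `t ≥ 0`. The sum
`y` over a period satisfies `c y = y + t δ`, and `⟨y, c y⟩ = -⟨y, y⟩` gives `2 q(y) = t ∂y ≤ 0`. So
`y` is a rational multiple of `δ` and has defect `0`, a contradiction
(`CoxeterDatum.exists_iterate_not_nonneg`).

Of the Euclidean diagrams only three facts are used: `δ` is positive, it lies in the radical, and
the graph is connected (`HasDiagram.isEuclidean`). -/

namespace FinQuiver

variable {V E : Type}

/-- The opposite quiver. -/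
def op (Q : FinQuiver V E) : FinQuiver V E := ⟨Q.tgt, Q.src⟩

/-! ### Opposite quivers and sequences of reflections of quivers. -/

section Reflect

variable [DecidableEq V]

theorem op_reflect (Q : FinQuiver V E) (i : V) : Q.op.reflect i = (Q.reflect i).op := by
  ext e <;> simp only [op, reflect, or_comm]

theorem op_reflectList (Q : FinQuiver V E) (l : List V) :
    Q.op.reflectList l = (Q.reflectList l).op := by
  induction l generalizing Q with
  | nil => rfl
  | cons i l ih => simp only [reflectList, op_reflect, ih]

theorem reflect_reflect (Q : FinQuiver V E) (i : V) : (Q.reflect i).reflect i = Q := by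
  ext e <;> simp only [reflect] <;> split_ifs <;> simp_all

theorem reflectList_append (Q : FinQuiver V E) (l₁ l₂ : List V) :
    Q.reflectList (l₁ ++ l₂) = (Q.reflectList l₁).reflectList l₂ := by
  induction l₁ generalizing Q with
  | nil => rfl
  | cons i l ih => exact ih _

theorem reflectList_reverse (Q : FinQuiver V E) (l : List V) :
    (Q.reflectList l).reflectList l.reverse = Q := by
  induction l generalizing Q with
  | nil => rfl
  | cons i l ih =>
    rw [List.reverse_cons, reflectList_append]
    simp only [reflectList]
    rw [ih, reflect_reflect]

theorem sinkSequence_append (Q : FinQuiver V E) (l₁ l₂ : List V) :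
    Q.SinkSequence (l₁ ++ l₂) ↔ Q.SinkSequence l₁ ∧ (Q.reflectList l₁).SinkSequence l₂ := by
  induction l₁ generalizing Q with
  | nil => simp [SinkSequence, reflectList]
  | cons i l ih => simp [SinkSequence, reflectList, ih, and_assoc]

theorem IsSink.op_reflect {Q : FinQuiver V E} {i : V} (h : Q.IsSink i) :
    (Q.reflect i).op.IsSink i := by
  intro e
  have := h e
  simp only [op, reflect]
  split_ifs <;> simp_all

/-- A sink that has just been reflected is a source, hence a sink of the opposite quiver, so the
reflections can be undone in reverse order there. This is what carries results on `C^+` over to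
`C^-`. -/
theorem SinkSequence.op_reverse {Q : FinQuiver V E} {l : List V} (h : Q.SinkSequence l) :
    (Q.reflectList l).op.SinkSequence l.reverse := by
  induction l generalizing Q with
  | nil => trivial
  | cons i l ih =>
    rw [List.reverse_cons, sinkSequence_append, op_reflectList]
    refine ⟨ih h.2, ?_, trivial⟩
    simp only [reflectList]
    rw [reflectList_reverse]
    exact h.1.op_reflect

end Reflect

/-! ### Simple reflections on integral vectors. -/

section Vectors

variable [DecidableEq V] [Fintype E]

/-- The sum of the coordinates of `x` over the edges at `i`. -/
def neighborSum (Q : FinQuiver V E) (i : V) (x : V → ℤ) : ℤ :=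
  ∑ e, ((if Q.src e = i then x (Q.tgt e) else 0) + if Q.tgt e = i then x (Q.src e) else 0)

theorem neighborSum_add (Q : FinQuiver V E) (i : V) (x y : V → ℤ) :
    Q.neighborSum i (x + y) = Q.neighborSum i x + Q.neighborSum i y := by
  simp only [neighborSum, ← Finset.sum_add_distrib]
  refine Finset.sum_congr rfl fun e _ => ?_
  split_ifs <;> (simp; try ring)

theorem neighborSum_smul (Q : FinQuiver V E) (i : V) (a : ℤ) (x : V → ℤ) :
    Q.neighborSum i (a • x) = a * Q.neighborSum i x := by
  simp only [neighborSum, Finset.mul_sum]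
  refine Finset.sum_congr rfl fun e _ => ?_
  split_ifs <;> (simp; try ring)

theorem neighborSum_op (Q : FinQuiver V E) : Q.op.neighborSum = Q.neighborSum := by
  ext i x
  exact Finset.sum_congr rfl fun e _ => add_comm _ _

/-- Only the underlying graph matters, so although the functors pass through different orientations,
all reflections of vectors can be computed in the original quiver. -/
theorem neighborSum_reflect (Q : FinQuiver V E) (j : V) :
    (Q.reflect j).neighborSum = Q.neighborSum := by
  ext i x
  refine Finset.sum_congr rfl fun e _ => ?_
  by_cases h : Q.src e = j ∨ Q.tgt e = j
  · simp only [reflect, h, if_true, add_comm]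
  · simp only [reflect, h, if_false]

/-- The simple reflection at the vertex `i`. -/
def reflection (Q : FinQuiver V E) (i : V) : (V → ℤ) →ₗ[ℤ] (V → ℤ) where
  toFun x := Function.update x i (Q.neighborSum i x - x i)
  map_add' x y := by
    ext j
    by_cases h : j = i
    · subst h; simp [neighborSum_add]; ring
    · simp [h]
  map_smul' a x := by
    ext j
    by_cases h : j = i
    · subst h
      simp only [Function.update_self, neighborSum_smul, Pi.smul_apply, smul_eq_mul,
        RingHom.id_apply]
      ring
    · simp [h]

theorem reflection_apply (Q : FinQuiver V E) (i : V) (x : V → ℤ) :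
    Q.reflection i x = Function.update x i (Q.neighborSum i x - x i) := rfl

@[simp]
theorem reflection_apply_self (Q : FinQuiver V E) (i : V) (x : V → ℤ) :
    Q.reflection i x i = Q.neighborSum i x - x i := by
  simp [reflection_apply]

theorem reflection_apply_of_ne (Q : FinQuiver V E) {i j : V} (h : j ≠ i) (x : V → ℤ) :
    Q.reflection i x j = x j := by
  simp [reflection_apply, h]

theorem reflection_op (Q : FinQuiver V E) : Q.op.reflection = Q.reflection := by
  ext1 i
  ext1 x
  simp only [reflection_apply, neighborSum_op]

theorem reflection_reflect (Q : FinQuiver V E) (j : V) :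
    (Q.reflect j).reflection = Q.reflection := by
  ext1 i
  refine LinearMap.ext fun x => ?_
  simp only [reflection_apply, neighborSum_reflect]

theorem reflection_eq_add (Q : FinQuiver V E) (i : V) (x : V → ℤ) :
    Q.reflection i x = x + (Q.neighborSum i x - 2 * x i) • Pi.single i 1 := by
  ext j
  by_cases h : j = i
  · subst h; simp; ring
  · simp [reflection_apply_of_ne Q h, h]

/-- The composite of the reflections at the vertices of a list, the first one being applied
first. -/
def reflectionList (Q : FinQuiver V E) : List V → (V → ℤ) →ₗ[ℤ] (V → ℤ)
  | [] => LinearMap.id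
  | i :: l => Q.reflectionList l ∘ₗ Q.reflection i

@[simp]
theorem reflectionList_cons (Q : FinQuiver V E) (i : V) (l : List V) (x : V → ℤ) :
    Q.reflectionList (i :: l) x = Q.reflectionList l (Q.reflection i x) := rfl

theorem reflectionList_append (Q : FinQuiver V E) (l₁ l₂ : List V) (x : V → ℤ) :
    Q.reflectionList (l₁ ++ l₂) x = Q.reflectionList l₂ (Q.reflectionList l₁ x) := by
  induction l₁ generalizing x with
  | nil => rfl
  | cons i l ih => exact ih _

theorem reflectionList_congr {Q Q' : FinQuiver V E} (h : Q.reflection = Q'.reflection)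
    (l : List V) : Q.reflectionList l = Q'.reflectionList l := by
  induction l with
  | nil => rfl
  | cons i l ih => simp only [reflectionList, h, ih]

theorem reflectionList_op (Q : FinQuiver V E) (l : List V) :
    Q.op.reflectionList l = Q.reflectionList l :=
  reflectionList_congr Q.reflection_op l

theorem reflectionList_reflect (Q : FinQuiver V E) (i : V) (l : List V) :
    (Q.reflect i).reflectionList l = Q.reflectionList l :=
  reflectionList_congr (Q.reflection_reflect i) l

theorem reflectionList_apply_of_notMem (Q : FinQuiver V E) {l : List V} {i : V} (h : i ∉ l)
    (x : V → ℤ) : Q.reflectionList l x i = x i := by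
  induction l generalizing x with
  | nil => rfl
  | cons j l ih =>
    rw [List.mem_cons, not_or] at h
    rw [reflectionList_cons, ih h.2, reflection_apply_of_ne Q h.1]

/-- There are no loops. -/
def Loopless (Q : FinQuiver V E) : Prop := ∀ e, Q.src e ≠ Q.tgt e

theorem Loopless.neighborSum_update {Q : FinQuiver V E} (hQ : Q.Loopless) (i : V)
    (x : V → ℤ) (a : ℤ) : Q.neighborSum i (Function.update x i a) = Q.neighborSum i x := by
  refine Finset.sum_congr rfl fun e _ => ?_
  have := hQ e
  congr 1 <;> refine if_ctx_congr Iff.rfl (fun h => ?_) fun _ => rfl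
  · rw [Function.update_of_ne]; rintro h'; exact this (h.trans h'.symm)
  · rw [Function.update_of_ne]; rintro h'; exact this (h'.trans h.symm)

theorem Loopless.reflection_reflection {Q : FinQuiver V E} (hQ : Q.Loopless) (i : V)
    (x : V → ℤ) : Q.reflection i (Q.reflection i x) = x := by
  simp only [reflection_apply, hQ.neighborSum_update, Function.update_idem,
    Function.update_self]
  simp

theorem Loopless.neighborSum_single {Q : FinQuiver V E} (hQ : Q.Loopless) (i : V) :
    Q.neighborSum i (Pi.single i 1) = 0 := by
  rw [Pi.single, hQ.neighborSum_update]
  simp [neighborSum]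

theorem Loopless.reflection_single {Q : FinQuiver V E} (hQ : Q.Loopless) (i : V) :
    Q.reflection i (Pi.single i 1) = -Pi.single i 1 := by
  rw [reflection_eq_add, hQ.neighborSum_single, Pi.single_eq_same]
  ext j
  simp only [Pi.add_apply, Pi.smul_apply, Pi.neg_apply, smul_eq_mul]
  ring

theorem Loopless.reflectionList_reverse {Q : FinQuiver V E} (hQ : Q.Loopless) (l : List V)
    (x : V → ℤ) : Q.reflectionList l.reverse (Q.reflectionList l x) = x := by
  induction l generalizing x with
  | nil => rfl
  | cons i l ih =>
    rw [List.reverse_cons, reflectionList_append, Q.reflectionList_cons i l, ih]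
    exact hQ.reflection_reflection i x

/-- Applying successively the reflections at the vertices of a list to `x`, one never has to
reflect a simple root at its own vertex. -/
def AvoidsSimple (Q : FinQuiver V E) : List V → (V → ℤ) → Prop
  | [], _ => True
  | i :: l, x => x ≠ Pi.single i 1 ∧ Q.AvoidsSimple l (Q.reflection i x)

theorem avoidsSimple_congr {Q Q' : FinQuiver V E} (h : Q.reflection = Q'.reflection)
    (l : List V) (x : V → ℤ) : Q.AvoidsSimple l x ↔ Q'.AvoidsSimple l x := by
  induction l generalizing x with
  | nil => rfl
  | cons i l ih => simp only [AvoidsSimple, h, ih]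

theorem exists_of_not_avoidsSimple {Q : FinQuiver V E} {l : List V} {x : V → ℤ}
    (h : ¬ Q.AvoidsSimple l x) :
    ∃ l₁ i l₂, l = l₁ ++ i :: l₂ ∧ Q.reflectionList l₁ x = Pi.single i 1 := by
  induction l generalizing x with
  | nil => exact absurd trivial h
  | cons i l ih =>
    by_cases hx : x = Pi.single i 1
    · exact ⟨[], i, l, rfl, hx⟩
    · obtain ⟨l₁, j, l₂, rfl, h'⟩ := ih fun h' => h ⟨hx, h'⟩
      exact ⟨i :: l₁, j, l₂, rfl, h'⟩

end Vectors

/-! ### The Euler form and its behaviour under reflections. -/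

section EulerForm

variable [Fintype V] [Fintype E]

theorem eulerForm_op (Q : FinQuiver V E) (x y : V → ℤ) :
    Q.op.eulerForm x y = Q.eulerForm y x := by
  simp only [eulerForm, op, mul_comm]

theorem quadForm_op (Q : FinQuiver V E) : Q.op.quadForm = Q.quadForm := by
  ext x
  exact eulerForm_op Q x x

variable [DecidableEq V]

/-- The matrix whose entry at `(a, b)` is the number of arrows `a ⟶ b`. -/
def arrowMatrix (Q : FinQuiver V E) : Matrix V V ℤ :=
  ∑ e, Matrix.single (Q.src e) (Q.tgt e) 1

theorem eulerForm_eq_dotProduct (Q : FinQuiver V E) (x y : V → ℤ) :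
    Q.eulerForm x y = x ⬝ᵥ ((1 - Q.arrowMatrix).mulVec y) := by
  rw [Matrix.sub_mulVec, dotProduct_sub, Matrix.one_mulVec, eulerForm, arrowMatrix,
    Matrix.sum_mulVec, dotProduct_sum]
  congr 1
  refine Finset.sum_congr rfl fun e _ => ?_
  simp [Matrix.single_mulVec, dotProduct, Function.update_apply]

theorem eulerForm_add_left (Q : FinQuiver V E) (x x' y : V → ℤ) :
    Q.eulerForm (x + x') y = Q.eulerForm x y + Q.eulerForm x' y := by
  simp only [eulerForm_eq_dotProduct, add_dotProduct]

theorem eulerForm_add_right (Q : FinQuiver V E) (x y y' : V → ℤ) :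
    Q.eulerForm x (y + y') = Q.eulerForm x y + Q.eulerForm x y' := by
  simp only [eulerForm_eq_dotProduct, Matrix.mulVec_add, dotProduct_add]

theorem eulerForm_smul_left (Q : FinQuiver V E) (a : ℤ) (x y : V → ℤ) :
    Q.eulerForm (a • x) y = a * Q.eulerForm x y := by
  simp only [eulerForm_eq_dotProduct, smul_dotProduct, smul_eq_mul]

theorem eulerForm_smul_right (Q : FinQuiver V E) (a : ℤ) (x y : V → ℤ) :
    Q.eulerForm x (a • y) = a * Q.eulerForm x y := by
  simp only [eulerForm_eq_dotProduct, Matrix.mulVec_smul, dotProduct_smul, smul_eq_mul]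

theorem eulerForm_neg_right (Q : FinQuiver V E) (x y : V → ℤ) :
    Q.eulerForm x (-y) = -Q.eulerForm x y := by
  simp only [eulerForm_eq_dotProduct, Matrix.mulVec_neg, dotProduct_neg]

theorem eulerForm_sum_left (Q : FinQuiver V E) {ι : Type} (s : Finset ι) (x : ι → V → ℤ)
    (y : V → ℤ) : Q.eulerForm (∑ j ∈ s, x j) y = ∑ j ∈ s, Q.eulerForm (x j) y := by
  simp only [eulerForm_eq_dotProduct, sum_dotProduct]

theorem eulerForm_sum_right (Q : FinQuiver V E) {ι : Type} (s : Finset ι) (x : V → ℤ)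
    (y : ι → V → ℤ) : Q.eulerForm x (∑ j ∈ s, y j) = ∑ j ∈ s, Q.eulerForm x (y j) := by
  simp only [eulerForm_eq_dotProduct, Matrix.mulVec_sum, dotProduct_sum]

theorem sum_mul_neighborSum (Q : FinQuiver V E) (x y : V → ℤ) :
    ∑ i, x i * Q.neighborSum i y =
      ∑ e, (x (Q.src e) * y (Q.tgt e) + x (Q.tgt e) * y (Q.src e)) := by
  simp only [neighborSum, Finset.mul_sum]
  rw [Finset.sum_comm]
  refine Finset.sum_congr rfl fun e _ => ?_
  simp [mul_add, Finset.sum_add_distrib]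

/-- In this shape the symmetrised form visibly vanishes when `y` satisfies the radical equations
`neighborSum i y = 2 * y i`. -/
theorem eulerForm_add_swap (Q : FinQuiver V E) (x y : V → ℤ) :
    Q.eulerForm x y + Q.eulerForm y x = ∑ i, x i * (2 * y i - Q.neighborSum i y) := by
  simp only [mul_sub, Finset.sum_sub_distrib, sum_mul_neighborSum, Finset.sum_add_distrib,
    eulerForm]
  have h1 : ∑ i, x i * (2 * y i) = ∑ i, x i * y i + ∑ i, y i * x i := by
    rw [← Finset.sum_add_distrib]
    exact Finset.sum_congr rfl fun i _ => by ring
  have h2 : ∑ e, y (Q.src e) * x (Q.tgt e) = ∑ e, x (Q.tgt e) * y (Q.src e) :=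
    Finset.sum_congr rfl fun e _ => mul_comm _ _
  rw [h1, h2]
  ring

theorem quadForm_add (Q : FinQuiver V E) (x y : V → ℤ) :
    Q.quadForm (x + y) = Q.quadForm x + Q.quadForm y +
      ∑ i, x i * (2 * y i - Q.neighborSum i y) := by
  rw [← eulerForm_add_swap, quadForm, quadForm, quadForm, eulerForm_add_left,
    eulerForm_add_right, eulerForm_add_right]
  ring

theorem quadForm_smul (Q : FinQuiver V E) (a : ℤ) (x : V → ℤ) :
    Q.quadForm (a • x) = a ^ 2 * Q.quadForm x := by
  rw [quadForm, quadForm, eulerForm_smul_left, eulerForm_smul_right]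
  ring

theorem Loopless.quadForm_single {Q : FinQuiver V E} (hQ : Q.Loopless) (i : V) :
    Q.quadForm (Pi.single i 1) = 1 := by
  have h := Q.eulerForm_add_swap (Pi.single i 1) (Pi.single i 1)
  rw [Finset.sum_eq_single i (fun j _ hj => by simp [hj]) (by simp), hQ.neighborSum_single,
    Pi.single_eq_same] at h
  rw [quadForm]
  linarith

theorem Loopless.quadForm_reflection {Q : FinQuiver V E} (hQ : Q.Loopless) (i : V)
    (x : V → ℤ) : Q.quadForm (Q.reflection i x) = Q.quadForm x := by
  rw [reflection_eq_add, add_comm, quadForm_add, quadForm_smul, hQ.quadForm_single,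
    Finset.sum_eq_single i]
  · simp; ring
  · intro j _ hj; simp [hj]
  · simp

theorem Loopless.quadForm_reflectionList {Q : FinQuiver V E} (hQ : Q.Loopless) (l : List V)
    (x : V → ℤ) : Q.quadForm (Q.reflectionList l x) = Q.quadForm x := by
  induction l generalizing x with
  | nil => rfl
  | cons i l ih => rw [reflectionList_cons, ih, hQ.quadForm_reflection]

/-- Let `N` be the neighbour sum at `i`, which runs over incoming arrows only. The terms involving
`i` are `x_i y_i - N(x) y_i` before and `(N(x) - x_i)(N(y) - y_i) - (N(x) - x_i) N(y)` after the
reflection, and these agree. -/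
theorem IsSink.eulerForm_reflection {Q : FinQuiver V E} {i : V} (hi : Q.IsSink i)
    (x y : V → ℤ) :
    (Q.reflect i).eulerForm (Q.reflection i x) (Q.reflection i y) = Q.eulerForm x y := by
  have hN : ∀ z : V → ℤ, Q.neighborSum i z = ∑ e, if Q.tgt e = i then z (Q.src e) else 0 :=
    fun z => Finset.sum_congr rfl fun e _ => by rw [if_neg (hi e), zero_add]
  have hV : ∀ z w : V → ℤ, ∑ j, z j * w j = z i * w i + ∑ j ∈ Finset.univ.erase i, z j * w j :=
    fun z w => (Finset.add_sum_erase _ _ (Finset.mem_univ i)).symm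
  have hV' : ∑ j ∈ Finset.univ.erase i, Q.reflection i x j * Q.reflection i y j =
      ∑ j ∈ Finset.univ.erase i, x j * y j :=
    Finset.sum_congr rfl fun j hj => by
      rw [reflection_apply_of_ne Q (Finset.ne_of_mem_erase hj),
        reflection_apply_of_ne Q (Finset.ne_of_mem_erase hj)]
  have hE : ∑ e, Q.reflection i x ((Q.reflect i).src e) * Q.reflection i y ((Q.reflect i).tgt e)
      = ∑ e, ((if Q.tgt e = i then 0 else x (Q.src e) * y (Q.tgt e)) +
        Q.reflection i x i * if Q.tgt e = i then y (Q.src e) else 0) := by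
    refine Finset.sum_congr rfl fun e _ => ?_
    have hs := hi e
    by_cases ht : Q.tgt e = i
    · simp only [reflect, ht, or_true, if_true, reflection_apply_of_ne Q hs, zero_add]
    · simp only [reflect, ht, hs, or_false, if_false, reflection_apply_of_ne Q hs,
        reflection_apply_of_ne Q ht, mul_zero, add_zero]
  have hE' : ∑ e, x (Q.src e) * y (Q.tgt e) =
      ∑ e, ((if Q.tgt e = i then 0 else x (Q.src e) * y (Q.tgt e)) +
        (if Q.tgt e = i then x (Q.src e) else 0) * y i) := by
    refine Finset.sum_congr rfl fun e _ => ?_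
    by_cases ht : Q.tgt e = i
    · simp [ht]
    · simp [ht]
  rw [eulerForm, eulerForm, hV, hV', hE, hE', hV x y, Finset.sum_add_distrib,
    Finset.sum_add_distrib, ← Finset.mul_sum, ← Finset.sum_mul, ← hN, ← hN,
    reflection_apply_self, reflection_apply_self]
  ring

theorem SinkSequence.eulerForm_reflectionList {Q : FinQuiver V E} {l : List V}
    (h : Q.SinkSequence l) (x y : V → ℤ) :
    (Q.reflectList l).eulerForm (Q.reflectionList l x) (Q.reflectionList l y) =
      Q.eulerForm x y := by
  induction l generalizing Q x y with
  | nil => rfl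
  | cons i l ih =>
    have := ih h.2 (Q.reflection i x) (Q.reflection i y)
    rw [reflectionList_reflect, h.1.eulerForm_reflection] at this
    exact this

theorem IsSink.eulerForm_single {Q : FinQuiver V E} {i : V} (hi : Q.IsSink i) (y : V → ℤ) :
    Q.eulerForm (Pi.single i 1) y = y i := by
  have : ∀ e, (Pi.single i 1 : V → ℤ) (Q.src e) = 0 := fun e => Pi.single_eq_of_ne (hi e) _
  simp [eulerForm, this, Pi.single_apply]

/-- The reflections along `l₁` are isometries onto the Euler form of a quiver with sink `i`, for
which `e_i` represents the `i`-th coordinate. They do not change that coordinate, because `i` does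
not occur in `l₁`. -/
theorem SinkSequence.eulerForm_eq_apply {Q : FinQuiver V E} {l₁ l₂ : List V} {i : V}
    (h : Q.SinkSequence (l₁ ++ i :: l₂)) (hn : (l₁ ++ i :: l₂).Nodup) {x : V → ℤ}
    (hx : Q.reflectionList l₁ x = Pi.single i 1) (y : V → ℤ) : Q.eulerForm x y = y i := by
  obtain ⟨h₁, h₂⟩ := (sinkSequence_append Q l₁ _).1 h
  rw [← h₁.eulerForm_reflectionList, hx, h₂.1.eulerForm_single]
  refine reflectionList_apply_of_notMem Q (fun hi => ?_) y
  exact (List.nodup_append.1 hn).2.2 i hi i List.mem_cons_self rfl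

end EulerForm

end FinQuiver

/-! ### Positive roots of a semidefinite form with radical vector `δ`. -/

namespace FinQuiver

variable {V E : Type} [Fintype E]

section PosRoot

variable [Fintype V]

/-- The positive roots of `Q`. -/
def IsPosRoot (Q : FinQuiver V E) (x : V → ℤ) : Prop := Q.IsRoot x ∧ 0 < x

theorem isPosRoot_op (Q : FinQuiver V E) : Q.op.IsPosRoot = Q.IsPosRoot := by
  ext x
  rw [IsPosRoot, IsPosRoot, IsRoot, IsRoot, quadForm_op]

end PosRoot

variable [DecidableEq V]

/-- The vector `δ` is positive and in the radical of the quadratic form of the connected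
loopless quiver `Q`. -/
structure IsEuclidean (Q : FinQuiver V E) (δ : V → ℤ) : Prop where
  pos : ∀ i, 0 < δ i
  loopless : Q.Loopless
  neighborSum_eq : ∀ i, Q.neighborSum i δ = 2 * δ i
  connected : ∀ P : V → Prop, (∀ e, P (Q.src e) ↔ P (Q.tgt e)) → ∀ i j, P i → P j

namespace IsEuclidean

variable {Q : FinQuiver V E} {δ : V → ℤ}

theorem op (h : Q.IsEuclidean δ) : Q.op.IsEuclidean δ where
  pos := h.pos
  loopless e := (h.loopless e).symm
  neighborSum_eq := by rw [neighborSum_op]; exact h.neighborSum_eq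
  connected P hP := h.connected P fun e => (hP e).symm

theorem reflectionList_self (h : Q.IsEuclidean δ) (l : List V) : Q.reflectionList l δ = δ := by
  induction l with
  | nil => rfl
  | cons i l ih =>
    rw [reflectionList_cons, reflection_eq_add, h.neighborSum_eq, sub_self, zero_smul,
      add_zero, ih]

variable [Fintype V]

theorem eulerForm_swap (h : Q.IsEuclidean δ) (x : V → ℤ) :
    Q.eulerForm x δ = -Q.eulerForm δ x := by
  have := Q.eulerForm_add_swap x δ
  simp only [h.neighborSum_eq, sub_self, mul_zero, Finset.sum_const_zero] at this
  linarith

theorem eulerForm_self (h : Q.IsEuclidean δ) : Q.eulerForm δ δ = 0 := by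
  linarith [h.eulerForm_swap δ]

/-- Expanding the squares, the coefficient of `z_i ^ 2` is the neighbour sum of `δ` at `i` divided
by `δ i`, which is `2`. Semidefiniteness, the radical and the finiteness of roots modulo `δ` are
read off from this sum of squares. -/
theorem two_mul_quadForm (h : Q.IsEuclidean δ) (z : V → ℤ) :
    (2 * Q.quadForm z : ℚ) = ∑ e, (δ (Q.src e) * δ (Q.tgt e) : ℚ) *
      (z (Q.src e) / δ (Q.src e) - z (Q.tgt e) / δ (Q.tgt e)) ^ 2 := by
  have hne : ∀ i, (δ i : ℚ) ≠ 0 := fun i => by exact_mod_cast (h.pos i).ne'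
  have h1 : ∑ i, (z i ^ 2 / δ i : ℚ) * (Q.neighborSum i δ : ℚ) = ∑ i, 2 * (z i * z i : ℚ) :=
    Finset.sum_congr rfl fun i _ => by
      rw [h.neighborSum_eq]
      push_cast
      have := hne i
      field_simp
  have h2 : ∑ i, (z i ^ 2 / δ i : ℚ) * (Q.neighborSum i δ : ℚ) =
      ∑ e, ((z (Q.src e) ^ 2 / δ (Q.src e) : ℚ) * δ (Q.tgt e) +
        (z (Q.tgt e) ^ 2 / δ (Q.tgt e) : ℚ) * δ (Q.src e)) := by
    simp only [neighborSum, Int.cast_sum, Int.cast_add, Int.cast_ite, Int.cast_zero,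
      Finset.mul_sum]
    rw [Finset.sum_comm]
    refine Finset.sum_congr rfl fun e _ => ?_
    simp [mul_add, Finset.sum_add_distrib]
  have h3 : ∀ e, (δ (Q.src e) * δ (Q.tgt e) : ℚ) *
      (z (Q.src e) / δ (Q.src e) - z (Q.tgt e) / δ (Q.tgt e)) ^ 2 =
      ((z (Q.src e) ^ 2 / δ (Q.src e) : ℚ) * δ (Q.tgt e) +
        (z (Q.tgt e) ^ 2 / δ (Q.tgt e) : ℚ) * δ (Q.src e)) -
      2 * (z (Q.src e) * z (Q.tgt e)) := fun e => by
    have := hne (Q.src e)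
    have := hne (Q.tgt e)
    field_simp
    ring
  rw [Finset.sum_congr rfl fun e _ => h3 e, Finset.sum_sub_distrib, ← h2, h1, quadForm,
    eulerForm, ← Finset.mul_sum, ← Finset.mul_sum]
  push_cast
  ring

theorem quadForm_nonneg (h : Q.IsEuclidean δ) (z : V → ℤ) : 0 ≤ Q.quadForm z := by
  have h0 : (0 : ℚ) ≤ 2 * Q.quadForm z := by
    rw [h.two_mul_quadForm]
    refine Finset.sum_nonneg fun e _ => mul_nonneg ?_ (sq_nonneg _)
    exact_mod_cast (mul_pos (h.pos _) (h.pos _)).le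
  have : (0 : ℚ) ≤ Q.quadForm z := by linarith
  exact_mod_cast this

theorem sq_le (h : Q.IsEuclidean δ) (z : V → ℤ) (e : E) :
    (z (Q.src e) * δ (Q.tgt e) - z (Q.tgt e) * δ (Q.src e)) ^ 2 ≤
      2 * Q.quadForm z * (δ (Q.src e) * δ (Q.tgt e)) := by
  have hs : (0 : ℚ) < δ (Q.src e) := by exact_mod_cast h.pos _
  have ht : (0 : ℚ) < δ (Q.tgt e) := by exact_mod_cast h.pos _
  have hle : (δ (Q.src e) * δ (Q.tgt e) : ℚ) *
      (z (Q.src e) / δ (Q.src e) - z (Q.tgt e) / δ (Q.tgt e)) ^ 2 ≤ 2 * Q.quadForm z := by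
    rw [h.two_mul_quadForm]
    refine Finset.single_le_sum (f := fun e => (δ (Q.src e) * δ (Q.tgt e) : ℚ) *
      (z (Q.src e) / δ (Q.src e) - z (Q.tgt e) / δ (Q.tgt e)) ^ 2)
      (fun e _ => mul_nonneg ?_ (sq_nonneg _)) (Finset.mem_univ e)
    exact_mod_cast (mul_pos (h.pos _) (h.pos _)).le
  have hmul := mul_le_mul_of_nonneg_right hle (mul_pos hs ht).le
  have heq : (δ (Q.src e) * δ (Q.tgt e) : ℚ) *
      (z (Q.src e) / δ (Q.src e) - z (Q.tgt e) / δ (Q.tgt e)) ^ 2 *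
      (δ (Q.src e) * δ (Q.tgt e)) =
      (z (Q.src e) * δ (Q.tgt e) - z (Q.tgt e) * δ (Q.src e)) ^ 2 := by
    field_simp
  rw [heq] at hmul
  exact_mod_cast hmul

/-- Every square vanishes, so the ratio `z / δ` is constant along arrows and, by connectedness,
everywhere. -/
theorem mul_eq_mul_of_quadForm_eq_zero (h : Q.IsEuclidean δ) {z : V → ℤ}
    (hz : Q.quadForm z = 0) (i j : V) : z i * δ j = z j * δ i := by
  refine h.connected (fun i => z i * δ j = z j * δ i) (fun e => ?_) j i rfl
  have he : z (Q.src e) * δ (Q.tgt e) = z (Q.tgt e) * δ (Q.src e) := by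
    have := h.sq_le z e
    rw [hz, mul_zero, zero_mul] at this
    exact sub_eq_zero.1 (pow_eq_zero_iff two_ne_zero |>.1 (le_antisymm this (sq_nonneg _)))
  constructor <;> intro h'
  · refine mul_left_cancel₀ (h.pos (Q.src e)).ne' ?_
    linear_combination δ (Q.tgt e) * h' - δ j * he
  · refine mul_left_cancel₀ (h.pos (Q.tgt e)).ne' ?_
    linear_combination δ (Q.src e) * h' + δ j * he

theorem eq_zero_or_pos_of_quadForm_eq_zero (h : Q.IsEuclidean δ) {z : V → ℤ}
    (hz : Q.quadForm z = 0) (hz0 : 0 ≤ z) : z = 0 ∨ ∀ i, 0 < z i := by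
  refine or_iff_not_imp_left.2 fun hne => ?_
  obtain ⟨j, hj⟩ := Function.ne_iff.1 hne
  have hj : 0 < z j := lt_of_le_of_ne (hz0 j) (Ne.symm hj)
  intro i
  have := h.mul_eq_mul_of_quadForm_eq_zero hz i j
  exact pos_of_mul_pos_left (this ▸ mul_pos hj (h.pos i)) (h.pos j).le

/-- The supports of `x⁺` and `x⁻` are disjoint, so `q(x) ≥ q(x⁺) + q(x⁻)` and one of the two
summands is `0`. The corresponding part is then zero or has full support; in the latter case the
other part is zero. -/
theorem nonneg_or_nonpos (h : Q.IsEuclidean δ) {x : V → ℤ} (hx : Q.quadForm x ≤ 1) :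
    0 ≤ x ∨ x ≤ 0 := by
  have hsplit : x = x⁺ + -x⁻ := by rw [← sub_eq_add_neg, posPart_sub_negPart]
  have hneg : Q.quadForm (-x⁻) = Q.quadForm x⁻ := by
    rw [← neg_one_smul ℤ, quadForm_smul]; ring
  have hdisj : ∀ i, x⁺ i * x⁻ i = 0 := fun i => by
    simp only [Pi.posPart_apply, Pi.negPart_apply]
    rcases le_total 0 (x i) with hi | hi
    · rw [negPart_eq_zero.2 hi, mul_zero]
    · rw [posPart_eq_zero.2 hi, zero_mul]
  have hp : 0 ≤ x⁺ := posPart_nonneg x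
  have hm : 0 ≤ x⁻ := negPart_nonneg x
  have hcross : 0 ≤ ∑ i, x⁺ i * (2 * (-x⁻) i - Q.neighborSum i (-x⁻)) := by
    refine Finset.sum_nonneg fun i _ => ?_
    have h1 : Q.neighborSum i (-x⁻) = -Q.neighborSum i x⁻ := by
      rw [← neg_one_smul ℤ, neighborSum_smul, neg_one_mul]
    have h2 : 0 ≤ Q.neighborSum i x⁻ := Finset.sum_nonneg fun e _ =>
      add_nonneg (by split_ifs <;> simp) (by split_ifs <;> simp)
    have h3 := mul_nonneg (hp i) h2
    have h4 := hdisj i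
    rw [h1, Pi.neg_apply]
    simp only at h3
    linarith [h3, h4, show x⁺ i * (2 * -x⁻ i - -Q.neighborSum i x⁻) =
      x⁺ i * Q.neighborSum i x⁻ - 2 * (x⁺ i * x⁻ i) by ring]
  have hq := Q.quadForm_add x⁺ (-x⁻)
  rw [← hsplit, hneg] at hq
  have hqp := h.quadForm_nonneg x⁺
  have hqm := h.quadForm_nonneg x⁻
  rcases (show Q.quadForm x⁺ = 0 ∨ Q.quadForm x⁻ = 0 by omega) with h0 | h0
  · rcases h.eq_zero_or_pos_of_quadForm_eq_zero h0 hp with h' | h'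
    · exact Or.inr (posPart_eq_zero.1 h')
    · refine Or.inl (negPart_eq_zero.1 (funext fun i => ?_))
      exact (mul_eq_zero.1 (hdisj i)).resolve_left (h' i).ne'
  · rcases h.eq_zero_or_pos_of_quadForm_eq_zero h0 hm with h' | h'
    · exact Or.inl (negPart_eq_zero.1 h')
    · refine Or.inr (posPart_eq_zero.1 (funext fun i => ?_))
      exact (mul_eq_zero.1 (hdisj i)).resolve_right (h' i).ne'

/-- A positive root other than `e_i` has a positive coordinate away from `i`, since `q(a e_i) = a ^
2`. The reflection keeps this coordinate, and the sign dichotomy for roots does the rest. -/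
theorem isPosRoot_reflection (h : Q.IsEuclidean δ) {x : V → ℤ} (hx : Q.IsPosRoot x) {i : V}
    (hi : x ≠ Pi.single i 1) : Q.IsPosRoot (Q.reflection i x) := by
  have hq : Q.quadForm (Q.reflection i x) ≤ 1 := by
    rw [h.loopless.quadForm_reflection]; exact hx.1.2
  obtain ⟨j, hji, hj⟩ : ∃ j, j ≠ i ∧ 0 < x j := by
    by_contra! hcon
    have hxe : x = x i • Pi.single i 1 := by
      ext j
      by_cases hj : j = i
      · subst hj; simp
      · simpa [hj] using le_antisymm (hcon j hj) (hx.2.le j)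
    have h1 : x i ≠ 1 := fun h1 => hi (by rw [hxe, h1, one_smul])
    have h0 : x i ≠ 0 := fun h0 => hx.1.1 (by rw [hxe, h0, zero_smul])
    have hi0 : 0 ≤ x i := hx.2.le i
    have := hx.1.2
    rw [hxe, quadForm_smul, h.loopless.quadForm_single] at this
    have h2 : 2 ≤ x i := by omega
    nlinarith
  have hj' : 0 < Q.reflection i x j := by rwa [reflection_apply_of_ne Q hji]
  have hne : Q.reflection i x ≠ 0 := fun h0 => by simp [h0] at hj'
  refine ⟨⟨hne, hq⟩, lt_of_le_of_ne ?_ hne.symm⟩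
  rcases h.nonneg_or_nonpos hq with h' | h'
  · exact h'
  · exact absurd (h' j) (not_le.2 hj')

theorem isPosRoot_reflectionList (h : Q.IsEuclidean δ) {l : List V} {x : V → ℤ}
    (hx : Q.IsPosRoot x) (hl : Q.AvoidsSimple l x) : Q.IsPosRoot (Q.reflectionList l x) := by
  induction l generalizing x with
  | nil => exact hx
  | cons i l ih => exact ih (h.isPosRoot_reflection hx hl.1) hl.2

/-- Fixing one coordinate removes the freedom of adding multiples of `δ`. Each square in the form
then bounds a coordinate in terms of an adjacent one, and connectedness spreads the bounds. -/
theorem finite_of_apply_eq_zero (h : Q.IsEuclidean δ) (j : V) (K : ℤ) :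
    {z : V → ℤ | z j = 0 ∧ Q.quadForm z ≤ K}.Finite := by
  have hb : ∀ i, ∃ B : ℤ, ∀ z : V → ℤ, z j = 0 → Q.quadForm z ≤ K → |z i| ≤ B := by
    intro i
    refine h.connected (fun i => ∃ B : ℤ, ∀ z : V → ℤ, z j = 0 → Q.quadForm z ≤ K → |z i| ≤ B)
      (fun e => ?_) j i ⟨0, fun z hz _ => by simp [hz]⟩
    have key : ∀ (a b : V), (∀ z : V → ℤ, (z a * δ b - z b * δ a) ^ 2 ≤
        2 * Q.quadForm z * (δ a * δ b)) →
        (∃ B : ℤ, ∀ z : V → ℤ, z j = 0 → Q.quadForm z ≤ K → |z a| ≤ B) →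
        ∃ B : ℤ, ∀ z : V → ℤ, z j = 0 → Q.quadForm z ≤ K → |z b| ≤ B := by
      rintro a b hab ⟨B, hB⟩
      refine ⟨B * δ b + 2 * K * (δ a * δ b), fun z hz hK => ?_⟩
      have ha := h.pos a
      have hb := h.pos b
      have h1 : |z b| ≤ |z b * δ a| := by
        rw [abs_mul, abs_of_pos ha]; exact le_mul_of_one_le_right (abs_nonneg _) ha
      have h2 : |z b * δ a| ≤ |z a * δ b| + |z a * δ b - z b * δ a| := by
        have := abs_sub_abs_le_abs_sub (z b * δ a) (z a * δ b)
        rw [abs_sub_comm (z b * δ a)] at this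
        linarith
      have h3 : |z a * δ b| ≤ B * δ b := by
        rw [abs_mul, abs_of_pos hb]; exact mul_le_mul_of_nonneg_right (hB z hz hK) hb.le
      have h4 : |z a * δ b - z b * δ a| ≤ (z a * δ b - z b * δ a) ^ 2 := by
        rw [← sq_abs]
        exact Int.le_self_sq _
      have h5 : 2 * Q.quadForm z * (δ a * δ b) ≤ 2 * K * (δ a * δ b) :=
        mul_le_mul_of_nonneg_right (by linarith) (mul_pos ha hb).le
      linarith [hab z]
    constructor
    · exact key _ _ fun z => h.sq_le z e
    · refine key _ _ fun z => ?_
      have := h.sq_le z e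
      rw [mul_comm (δ (Q.tgt e))]
      linarith [show (z (Q.src e) * δ (Q.tgt e) - z (Q.tgt e) * δ (Q.src e)) ^ 2 =
        (z (Q.tgt e) * δ (Q.src e) - z (Q.src e) * δ (Q.tgt e)) ^ 2 by ring]
  choose B hB using hb
  refine (Set.finite_Icc (fun i => -B i) B).subset fun z hz => ?_
  exact ⟨fun i => (abs_le.1 (hB i z hz.1 hz.2)).1, fun i => (abs_le.1 (hB i z hz.1 hz.2)).2⟩

end IsEuclidean

/-! ### The Coxeter transformation and its orbits on positive roots. -/

variable [Fintype V]

/-- A quiver with radical vector `δ`, an admissible ordering `l` of its vertices, and the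
families `p` and `h` of vectors which are dual to the coordinates with respect to the Euler
form. -/
structure CoxeterDatum (Q : FinQuiver V E) (δ : V → ℤ) (l : List V) (p h : V → V → ℤ) :
    Prop where
  isEuclidean : Q.IsEuclidean δ
  nodup : l.Nodup
  mem : ∀ i, i ∈ l
  sinks : Q.SinkSequence l
  eulerForm_p : ∀ i y, Q.eulerForm (p i) y = y i
  eulerForm_h : ∀ i y, Q.eulerForm y (h i) = y i
  p_nonneg : ∀ i, 0 ≤ p i
  h_nonneg : ∀ i, 0 ≤ h i

namespace CoxeterDatum

variable {Q : FinQuiver V E} {δ : V → ℤ} {l : List V} {p h : V → V → ℤ}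

theorem op (D : Q.CoxeterDatum δ l p h) : Q.op.CoxeterDatum δ l.reverse h p where
  isEuclidean := D.isEuclidean.op
  nodup := List.nodup_reverse.2 D.nodup
  mem i := List.mem_reverse.2 (D.mem i)
  sinks := by
    have := D.sinks.op_reverse
    rwa [Q.reflectList_eq_self l D.nodup D.mem] at this
  eulerForm_p i y := (eulerForm_op Q _ _).trans (D.eulerForm_h i y)
  eulerForm_h i y := (eulerForm_op Q _ _).trans (D.eulerForm_p i y)
  p_nonneg := D.h_nonneg
  h_nonneg := D.p_nonneg

theorem eq_of_eulerForm_eq (D : Q.CoxeterDatum δ l p h) {x x' : V → ℤ}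
    (hx : ∀ y, Q.eulerForm x y = Q.eulerForm x' y) : x = x' := by
  ext i
  rw [← D.eulerForm_h i x, ← D.eulerForm_h i x', hx]

theorem eq_p_of_reflectionList_eq (D : Q.CoxeterDatum δ l p h) {l₁ l₂ : List V} {i : V}
    (hl : l = l₁ ++ i :: l₂) {x : V → ℤ} (hx : Q.reflectionList l₁ x = Pi.single i 1) :
    x = p i := by
  refine D.eq_of_eulerForm_eq fun y => ?_
  rw [D.eulerForm_p]
  exact (hl ▸ D.sinks).eulerForm_eq_apply (hl ▸ D.nodup) hx y

/-- The vectors `p i` are the only possible obstructions to applying `C^+`. -/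
theorem eq_p_of_not_avoidsSimple (D : Q.CoxeterDatum δ l p h) {x : V → ℤ}
    (hx : ¬ Q.AvoidsSimple l x) : ∃ i, x = p i := by
  obtain ⟨l₁, i, l₂, hl, h'⟩ := exists_of_not_avoidsSimple hx
  exact ⟨i, D.eq_p_of_reflectionList_eq hl h'⟩

theorem reflectionList_p (D : Q.CoxeterDatum δ l p h) {l₁ l₂ : List V} {i : V}
    (hl : l = l₁ ++ i :: l₂) : Q.reflectionList l₁ (p i) = Pi.single i 1 := by
  have hx : Q.reflectionList l₁ (Q.reflectionList l₁.reverse (Pi.single i 1)) =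
      Pi.single i 1 := by
    have := D.isEuclidean.loopless.reflectionList_reverse l₁.reverse (Pi.single i 1)
    rwa [List.reverse_reverse] at this
  rw [← D.eq_p_of_reflectionList_eq hl hx, hx]

/-- Split the ordering at `i`: the reflections before `i` take `p i` to `e_i`, the one at `i`
changes the sign, and those after `i` take `e_i` to `h i`, by the opposite of the first step. -/
theorem coxeter_p (D : Q.CoxeterDatum δ l p h) (i : V) : Q.reflectionList l (p i) = -h i := by
  obtain ⟨l₁, l₂, hl⟩ := List.append_of_mem (D.mem i)
  have hl' : l.reverse = l₂.reverse ++ i :: l₁.reverse := by rw [hl]; simp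
  have hh := D.op.reflectionList_p hl'
  rw [reflectionList_op] at hh
  have hh' : Q.reflectionList l₂ (Pi.single i 1) = h i := by
    have := D.isEuclidean.loopless.reflectionList_reverse l₂.reverse (h i)
    rwa [List.reverse_reverse, hh] at this
  conv_lhs => rw [hl]
  rw [reflectionList_append, D.reflectionList_p hl, reflectionList_cons,
    D.isEuclidean.loopless.reflection_single, map_neg, hh']

theorem isPosRoot_p (D : Q.CoxeterDatum δ l p h) (i : V) : Q.IsPosRoot (p i) := by
  have h0 : p i ≠ 0 := fun h0 => by
    have := D.eulerForm_p i (fun _ => 1)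
    rw [h0] at this
    simp [eulerForm] at this
  obtain ⟨l₁, l₂, hl⟩ := List.append_of_mem (D.mem i)
  refine ⟨⟨h0, ?_⟩, lt_of_le_of_ne (D.p_nonneg i) h0.symm⟩
  rw [← D.isEuclidean.loopless.quadForm_reflectionList l₁, D.reflectionList_p hl,
    D.isEuclidean.loopless.quadForm_single]

theorem isPosRoot_h (D : Q.CoxeterDatum δ l p h) (i : V) : Q.IsPosRoot (h i) := by
  have := D.op.isPosRoot_p i
  rwa [isPosRoot_op] at this

theorem defect_p (D : Q.CoxeterDatum δ l p h) (i : V) : Q.eulerForm δ (p i) = -δ i := by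
  rw [← D.eulerForm_p i δ, D.isEuclidean.eulerForm_swap, neg_neg]

theorem eulerForm_coxeter (D : Q.CoxeterDatum δ l p h) (x y : V → ℤ) :
    Q.eulerForm (Q.reflectionList l x) (Q.reflectionList l y) = Q.eulerForm x y := by
  have := D.sinks.eulerForm_reflectionList x y
  rwa [Q.reflectList_eq_self l D.nodup D.mem] at this

theorem defect_coxeter (D : Q.CoxeterDatum δ l p h) (x : V → ℤ) :
    Q.eulerForm δ (Q.reflectionList l x) = Q.eulerForm δ x := by
  have := D.eulerForm_coxeter δ x
  rwa [D.isEuclidean.reflectionList_self] at this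

theorem defect_iterate (D : Q.CoxeterDatum δ l p h) (r : ℕ) (x : V → ℤ) :
    Q.eulerForm δ ((Q.reflectionList l)^[r] x) = Q.eulerForm δ x := by
  induction r with
  | zero => rfl
  | succ r ih => rw [Function.iterate_succ_apply', D.defect_coxeter, ih]

/-- Both sides are linear in `x`, and the `p i` span, so this reduces to `c p_i = -h_i` and the
duality of `p` and `h` with the coordinates. -/
theorem eulerForm_coxeter_right (D : Q.CoxeterDatum δ l p h) (x y : V → ℤ) :
    Q.eulerForm y (Q.reflectionList l x) = -Q.eulerForm x y := by
  have hy : ∀ y, Q.eulerForm x y = ∑ i, Q.eulerForm x (Pi.single i 1) * y i := fun y => by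
    conv_lhs => rw [pi_eq_sum_univ' y]
    rw [eulerForm_sum_right]
    refine Finset.sum_congr rfl fun i _ => ?_
    rw [eulerForm_smul_right, mul_comm]
  have hx : x = ∑ i, Q.eulerForm x (Pi.single i 1) • p i :=
    D.eq_of_eulerForm_eq fun y => by
      rw [eulerForm_sum_left, hy]
      exact Finset.sum_congr rfl fun i _ => by rw [eulerForm_smul_left, D.eulerForm_p]
  rw [hy y]
  conv_lhs => rw [hx]
  rw [map_sum, eulerForm_sum_right, ← Finset.sum_neg_distrib]
  refine Finset.sum_congr rfl fun i _ => ?_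
  rw [map_smul, eulerForm_smul_right, D.coxeter_p, eulerForm_neg_right, D.eulerForm_h]
  ring

theorem avoidsSimple_of_defect_pos (D : Q.CoxeterDatum δ l p h) {x : V → ℤ}
    (hx : 0 < Q.eulerForm δ x) : Q.AvoidsSimple l x := by
  by_contra hcon
  obtain ⟨i, rfl⟩ := D.eq_p_of_not_avoidsSimple hcon
  rw [D.defect_p] at hx
  linarith [D.isEuclidean.pos i]

theorem defect_h (D : Q.CoxeterDatum δ l p h) (i : V) : Q.eulerForm δ (h i) = δ i :=
  D.eulerForm_h i δ

theorem isPosRoot_iterate_h (D : Q.CoxeterDatum δ l p h) (i : V) (r : ℕ) :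
    Q.IsPosRoot ((Q.reflectionList l)^[r] (h i)) ∧
      Q.AvoidsSimple l ((Q.reflectionList l)^[r] (h i)) := by
  have ha : ∀ r, Q.AvoidsSimple l ((Q.reflectionList l)^[r] (h i)) := fun r =>
    D.avoidsSimple_of_defect_pos (by
      rw [D.defect_iterate, D.defect_h]; exact D.isEuclidean.pos i)
  refine ⟨?_, ha r⟩
  induction r with
  | zero => exact D.isPosRoot_h i
  | succ r ih =>
    rw [Function.iterate_succ_apply']
    exact D.isEuclidean.isPosRoot_reflectionList ih (ha r)

/-- After cancelling powers of `c`, different exponents leave `h i = c^(m+1) (h j)`. Applying the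
inverse of `c` turns this into `-p i = c^m (h j)`, a negative vector equal to a positive one. -/
theorem iterate_h_inj (D : Q.CoxeterDatum δ l p h) {i j : V} {r s : ℕ}
    (hrs : (Q.reflectionList l)^[r] (h i) = (Q.reflectionList l)^[s] (h j)) :
    i = j ∧ r = s := by
  have hinj : Function.Injective (Q.reflectionList l) :=
    Function.LeftInverse.injective (D.isEuclidean.loopless.reflectionList_reverse l)
  have key : ∀ (i j : V) (m : ℕ), h i ≠ (Q.reflectionList l)^[m + 1] (h j) := fun i j m hm => by
    have h1 := congrArg (Q.reflectionList l.reverse) hm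
    have h2 := D.op.coxeter_p i
    rw [reflectionList_op] at h2
    rw [Function.iterate_succ_apply', D.isEuclidean.loopless.reflectionList_reverse, h2] at h1
    have h3 := (D.isPosRoot_iterate_h j m).1.2
    rw [← h1] at h3
    exact lt_asymm (D.isPosRoot_p i).2 (neg_pos.1 h3)
  induction r generalizing s with
  | zero =>
    cases s with
    | zero =>
      refine ⟨?_, rfl⟩
      have h1 : (Pi.single i 1 : V → ℤ) i = (Pi.single i 1 : V → ℤ) j := by
        rw [← D.eulerForm_h i (Pi.single i 1), ← D.eulerForm_h j (Pi.single i 1)]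
        exact congrArg _ hrs
      by_contra hij
      simp [Ne.symm hij] at h1
    | succ s => exact absurd hrs (key i j s)
  | succ r ih =>
    cases s with
    | zero => exact absurd hrs.symm (key j i r)
    | succ s =>
      rw [Function.iterate_succ_apply', Function.iterate_succ_apply'] at hrs
      obtain ⟨h1, h2⟩ := ih (hinj hrs)
      exact ⟨h1, by rw [h2]⟩

/-- This replaces an explicit formula for a power of `c` in terms of the defect: negative defect is
incompatible with an orbit that stays non-negative. -/
theorem exists_iterate_not_nonneg (D : Q.CoxeterDatum δ l p h) {x : V → ℤ}
    (hq : Q.quadForm x ≤ 1) (hx : Q.eulerForm δ x < 0) :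
    ∃ r, ¬ 0 ≤ (Q.reflectionList l)^[r] x := by
  by_contra! hcon
  set c := Q.reflectionList l with hc
  have H := D.isEuclidean
  have hne : Nonempty V := by
    by_contra hV
    rw [not_nonempty_iff] at hV
    have : IsEmpty E := ⟨fun e => hV.false (Q.src e)⟩
    simp [eulerForm] at hx
  obtain ⟨j⟩ := hne
  have hqr : ∀ r, Q.quadForm (c^[r] x) ≤ 1 := fun r => by
    induction r with
    | zero => exact hq
    | succ r ih => rwa [Function.iterate_succ_apply', hc, H.loopless.quadForm_reflectionList]
  have hδq : ∀ a : ℤ, ∀ z, Q.quadForm (z + a • δ) = Q.quadForm z := fun a z => by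
    rw [quadForm_add, quadForm_smul, quadForm, quadForm, H.eulerForm_self,
      Finset.sum_eq_zero fun i _ => ?_]
    · ring
    · rw [neighborSum_smul, H.neighborSum_eq, Pi.smul_apply, smul_eq_mul]; ring
  -- The representative modulo `δ` with vanishing coordinate at `j`; the factor `δ j` keeps it
  -- integral, and adding multiples of `δ` does not change `q`.
  let g : ℕ → V → ℤ := fun r => δ j • c^[r] x + (-(c^[r] x j)) • δ
  have hg : ∀ r, g r ∈ {z : V → ℤ | z j = 0 ∧ Q.quadForm z ≤ δ j ^ 2} := fun r => by
    refine ⟨?_, ?_⟩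
    · simp only [g, Pi.add_apply, Pi.smul_apply, smul_eq_mul]; ring
    · simp only [g]
      rw [hδq, quadForm_smul]
      exact mul_le_of_le_one_right (sq_nonneg _) (hqr r)
  have hpig : ∃ a b, a < b ∧ g a = g b := by
    have := (H.finite_of_apply_eq_zero j (δ j ^ 2)).to_subtype
    obtain ⟨a, b, hab, h'⟩ := Finite.exists_ne_map_eq_of_infinite
      (fun r : ℕ => (⟨g r, hg r⟩ : {z : V → ℤ | z j = 0 ∧ Q.quadForm z ≤ δ j ^ 2}))
    have h' : g a = g b := congrArg Subtype.val h'
    rcases lt_or_gt_of_ne hab with hlt | hlt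
    · exact ⟨a, b, hlt, h'⟩
    · exact ⟨b, a, hlt, h'.symm⟩
  obtain ⟨a, b, hab, hgab⟩ := hpig
  obtain ⟨m, rfl⟩ := Nat.exists_eq_add_of_lt hab
  set x' := δ j • c^[a] x with hx'
  have hiter : ∀ (r : ℕ) (t : ℤ) (z : V → ℤ), c^[r] (t • z) = t • c^[r] z := fun r t z => by
    induction r with
    | zero => rfl
    | succ r ih => rw [Function.iterate_succ_apply', ih, map_smul, Function.iterate_succ_apply']
  have hiterδ : ∀ (r : ℕ) (t : ℤ) (z : V → ℤ), c^[r] (z + t • δ) = c^[r] z + t • δ :=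
    fun r t z => by
      induction r with
      | zero => rfl
      | succ r ih =>
        rw [Function.iterate_succ_apply', ih, map_add, map_smul, hc, H.reflectionList_self,
          Function.iterate_succ_apply']
  obtain ⟨t, ht⟩ : ∃ t : ℤ, c^[m + 1] x' = x' + t • δ := by
    -- The difference of the multiples of `δ` that were subtracted in the two equal values of `g`.
    refine ⟨c^[a + m + 1] x j - c^[a] x j, ?_⟩
    rw [hx', hiter, ← Function.iterate_add_apply, show m + 1 + a = a + m + 1 by ring]
    have := hgab
    simp only [g] at this
    rw [← sub_eq_zero] at this ⊢
    rw [← neg_eq_zero, ← this]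
    module
  have hpos : ∀ r, 0 ≤ c^[r] x' := fun r => by
    rw [hx', hiter, ← Function.iterate_add_apply]
    exact smul_nonneg (H.pos j).le (hcon _)
  have hmult : ∀ s : ℕ, c^[s * (m + 1)] x' = x' + ((s : ℤ) * t) • δ := fun s => by
    induction s with
    | zero => simp
    | succ s ih =>
      rw [Nat.succ_mul, Nat.add_comm, Function.iterate_add_apply, ih, hiterδ, ht]
      push_cast
      module
  have ht0 : 0 ≤ t := by
    by_contra! hneg
    have h0 := hpos 0 j
    -- After `x' j + 1` periods, a negative `t` would have lowered the coordinate at `j` by at least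
    -- `x' j + 1`.
    have h1 := hpos ((x' j + 1).toNat * (m + 1)) j
    rw [hmult] at h1
    simp only [Function.iterate_zero, id_eq, Pi.zero_apply, Pi.add_apply, Pi.smul_apply,
      smul_eq_mul] at h0 h1
    rw [Int.toNat_of_nonneg (by linarith)] at h1
    have h2 : t * δ j ≤ -1 := by nlinarith [H.pos j]
    nlinarith
  -- Applying `c` shifts the sum over the period, which changes it only by `c^(m+1) x' - x' = t δ`.
  set y := ∑ r ∈ Finset.range (m + 1), c^[r] x' with hy
  have hcy : c y = y + t • δ := by
    rw [hy, map_sum]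
    have h1 := Finset.sum_range_succ (fun r => c^[r] x') (m + 1)
    have h2 := Finset.sum_range_succ' (fun r => c^[r] x') (m + 1)
    rw [h1] at h2
    simp only [Function.iterate_succ_apply', Function.iterate_zero, id_eq] at h2
    have h3 := ht
    rw [Function.iterate_succ_apply'] at h3
    rw [h3, add_comm x', ← add_assoc] at h2
    exact (add_right_cancel h2).symm
  have hdy : Q.eulerForm δ y < 0 := by
    rw [hy, eulerForm_sum_right]
    refine Finset.sum_neg (fun r _ => ?_) ⟨0, by simp⟩
    rw [hc, D.defect_iterate, hx', eulerForm_smul_right, D.defect_iterate]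
    exact mul_neg_of_pos_of_neg (H.pos j) hx
  -- Evaluate `⟨y, c y⟩` in two ways: as `-q(y)`, and as `q(y) + t ⟨y, δ⟩ = q(y) - t ∂y`.
  have hqy : 2 * Q.quadForm y = t * Q.eulerForm δ y := by
    have h1 := D.eulerForm_coxeter_right y y
    rw [← hc, hcy, eulerForm_add_right, eulerForm_smul_right, H.eulerForm_swap] at h1
    rw [quadForm]
    linarith
  have hy0 : Q.quadForm y = 0 := by
    have := H.quadForm_nonneg y
    nlinarith
  have hyδ : δ j • y = y j • δ := by
    ext i
    simp only [Pi.smul_apply, smul_eq_mul]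
    linarith [H.mul_eq_mul_of_quadForm_eq_zero hy0 i j]
  have h1 : δ j * Q.eulerForm δ y = 0 := by
    rw [← eulerForm_smul_right, hyδ, eulerForm_smul_right, H.eulerForm_self, mul_zero]
  rcases mul_eq_zero.1 h1 with h2 | h2
  · exact (H.pos j).ne' h2
  · exact hdy.ne h2

/-- As long as the orbit of `x` under `c` meets no `p i`, it consists of positive roots, which
cannot go on forever. -/
theorem exists_eq_iterate_p (D : Q.CoxeterDatum δ l p h) {x : V → ℤ} (hx : Q.IsPosRoot x)
    (hd : Q.eulerForm δ x < 0) : ∃ i r, x = (Q.reflectionList l.reverse)^[r] (p i) := by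
  by_contra! hcon
  have hpos : ∀ r, Q.IsPosRoot ((Q.reflectionList l)^[r] x) := fun r => by
    induction r with
    | zero => exact hx
    | succ r ih =>
      rw [Function.iterate_succ_apply']
      refine D.isEuclidean.isPosRoot_reflectionList ih ?_
      by_contra ha
      obtain ⟨i, hi⟩ := D.eq_p_of_not_avoidsSimple ha
      refine hcon i r ?_
      rw [← hi]
      exact (Function.LeftInverse.iterate
        (D.isEuclidean.loopless.reflectionList_reverse l) r x).symm
  obtain ⟨r, hr⟩ := D.exists_iterate_not_nonneg hx.1.2 hd
  exact hr (hpos r).2.le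

end CoxeterDatum

end FinQuiver

/-! ### Subrepresentations, and indecomposables supported at one vertex. -/

namespace QuiverRep

variable {V E : Type} {k : Type u} [Field k]

section General

variable {Q : FinQuiver V E}

/-- The ends of an arrow of `Q.reflect i` are only propositionally equal to vertices of `Q`; with
free names `i`, `j` for them the transports can be substituted away. -/
theorem IsSubrep.map_castObj_mem {X : QuiverRep k Q} {U : ∀ i, Submodule k (X.obj i)}
    (hU : X.IsSubrep U) (e : E) {i j : V} (hi : i = Q.src e) (hj : Q.tgt e = j) {x : X.obj i}
    (hx : x ∈ U i) : X.castObj hj (X.map e (X.castObj hi x)) ∈ U j := by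
  subst hi hj
  exact hU e x hx

theorem isCompl_comap {M N : Type*} [AddCommGroup M] [Module k M] [AddCommGroup N] [Module k N]
    (f : M ≃ₗ[k] N) {U W : Submodule k N} (h : IsCompl U W) :
    IsCompl (U.comap f.toLinearMap) (W.comap f.toLinearMap) :=
  (Submodule.orderIsoMapComap f).symm.isCompl h

theorem comap_eq_bot_iff {M N : Type*} [AddCommGroup M] [Module k M] [AddCommGroup N]
    [Module k N] (f : M ≃ₗ[k] N) {U : Submodule k N} :
    U.comap f.toLinearMap = ⊥ ↔ U = ⊥ :=
  map_eq_bot_iff (Submodule.orderIsoMapComap f).symm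

variable [DecidableEq V]

theorem isCompl_update {X : QuiverRep k Q} {U W : ∀ i, Submodule k (X.obj i)}
    {i : V} {A B : Submodule k (X.obj i)} (hAB : IsCompl A B)
    (h : ∀ j, j ≠ i → IsCompl (U j) (W j)) (j : V) :
    IsCompl (Function.update U i A j) (Function.update W i B j) := by
  by_cases hj : j = i
  · subst hj; simpa using hAB
  · simpa [hj] using h j hj

/-- All maps are zero, so every family of subspaces is a subrepresentation, and a complement of a
line in `X_i` has to vanish. -/
theorem Indecomposable.dimVector_eq_single {X : QuiverRep k Q} (hX : X.Indecomposable) {i : V}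
    (hl : ∀ e, Q.src e = i → Q.tgt e ≠ i) (h : ∀ j, j ≠ i → Subsingleton (X.obj j)) :
    X.dimVector = Pi.single i 1 := by
  obtain ⟨j, hj⟩ := hX.1
  have hji : j = i := by
    by_contra hji
    have := h j hji
    exact not_subsingleton (X.obj j) this
  subst hji
  obtain ⟨v, hv⟩ := exists_ne (0 : X.obj j)
  obtain ⟨L, hL⟩ := Submodule.exists_isCompl (Submodule.span k {v})
  have hsub : ∀ U, X.IsSubrep U := fun U e x hx => by
    by_cases hs : Q.src e = j
    · have := h _ (hl e hs)
      rw [Subsingleton.elim (X.map e x) 0]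
      exact zero_mem _
    · have := h _ hs
      rw [Subsingleton.elim x 0, map_zero]
      exact zero_mem _
  have hL' : L = ⊥ := by
    rcases hX.2 _ _ (hsub (Function.update (fun _ => ⊥) j (Submodule.span k {v})))
      (hsub (Function.update (fun _ => ⊤) j L))
      (isCompl_update hL fun _ _ => isCompl_bot_top) with h' | h'
    · have := h' j
      rw [Function.update_self, Submodule.span_singleton_eq_bot] at this
      exact absurd this hv
    · simpa using h' j
  have htop : Submodule.span k {v} = ⊤ := by
    have := hL.sup_eq_top
    rwa [hL', sup_bot_eq] at this
  ext m
  by_cases hm : m = j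
  · subst hm
    rw [Pi.single_eq_same, dimVector, ← finrank_top, ← htop, finrank_span_singleton hv,
      Nat.cast_one]
  · have := h m hm
    rw [Pi.single_eq_of_ne hm, dimVector, Module.finrank_zero_of_subsingleton, Nat.cast_zero]

end General

/-! ### The reflection functor at a source. -/

section Minus

variable {Q : FinQuiver V E}

theorem outMap_apply (X : QuiverRep k Q) {e : E} (x : X.obj (Q.src e)) :
    X.outMap (Q.src e) x ⟨e, rfl⟩ = X.map e x := rfl

variable [DecidableEq V]

/-- The kernel, placed at the source `i`, splits off as a direct summand. If the complementary
summand vanishes, `X` lives at `i` alone. -/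
theorem Indecomposable.outMap_injective {X : QuiverRep k Q} (hX : X.Indecomposable) {i : V}
    (hi : Q.op.IsSink i) (hd : X.dimVector ≠ Pi.single i 1) :
    LinearMap.ker (X.outMap i) = ⊥ := by
  have hi : ∀ e, Q.tgt e ≠ i := hi
  obtain ⟨L, hL⟩ := Submodule.exists_isCompl (LinearMap.ker (X.outMap i))
  have hU : X.IsSubrep (Function.update (fun _ => ⊥) i (LinearMap.ker (X.outMap i))) := by
    intro e x hx
    rw [Function.update_of_ne (hi e), Submodule.mem_bot]
    by_cases hs : Q.src e = i
    · subst hs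
      rw [Function.update_self, LinearMap.mem_ker] at hx
      rw [← outMap_apply, hx, Pi.zero_apply]
    · rw [Function.update_of_ne hs, Submodule.mem_bot] at hx
      rw [hx, map_zero]
  have hW : X.IsSubrep (Function.update (fun _ => ⊤) i L) := by
    intro e x _
    rw [Function.update_of_ne (hi e)]
    trivial
  rcases hX.2 _ _ hU hW (isCompl_update hL fun _ _ => isCompl_bot_top) with h | h
  · simpa using h i
  · refine absurd (hX.dimVector_eq_single (fun e _ => hi e) fun j hj => ?_) hd
    have := h j
    rw [Function.update_of_ne hj] at this
    exact (Submodule.subsingleton_iff k).1 (subsingleton_of_bot_eq_top this.symm)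

variable [DecidableEq E] (X : QuiverRep k Q) (i : V)

/-- The identification of `(S_i^- X)_j` with `X_j`, for `j ≠ i`. -/
def minusEquiv {j : V} (h : j ≠ i) : X.obj j ≃ₗ[k] (X.reflMinus i).obj j :=
  (Pick.negEquiv (decEq j i) k h).symm

/-- The identification of `(S_i^- X)_i` with the cokernel of `outMap`. -/
def minusEquivSelf :
    (((e : {e : E // Q.src e = i}) → X.obj (Q.tgt e)) ⧸ LinearMap.range (X.outMap i)) ≃ₗ[k]
      (X.reflMinus i).obj i :=
  (Pick.posEquiv (decEq i i) k rfl).symm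

theorem castObj_minusEquiv {a b : V} (h : a = b) (ha : a ≠ i) (hb : b ≠ i) (x : X.obj b) :
    X.castObj h ((Pick.negEquiv (decEq a i) k ha : X.minusObj i a ≃ₗ[k] X.obj a)
      ((X.reflMinus i).castObj h.symm (X.minusEquiv i hb x))) = x := by
  subst h
  exact (Pick.negEquiv (decEq a i) k ha : X.minusObj i a ≃ₗ[k] X.obj a).apply_symm_apply x

theorem castObj_negEquiv_symm_minus {a b : V} (h : a = b) (ha : a ≠ i) (hb : b ≠ i)
    (x : X.obj b) : (X.reflMinus i).castObj h
      ((Pick.negEquiv (decEq a i) k ha).symm (X.castObj h.symm x)) = X.minusEquiv i hb x := by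
  subst h; rfl

theorem castObj_posEquiv_symm_minus {a : V} (h : a = i)
    (x : ((e : {e : E // Q.src e = i}) → X.obj (Q.tgt e)) ⧸ LinearMap.range (X.outMap i)) :
    (X.reflMinus i).castObj h ((Pick.posEquiv (decEq a i) k h).symm x) =
      X.minusEquivSelf i x := by
  subst h; rfl

variable {X i}

/-- This lemma and the next express the maps of `S_i^- X` through closure properties of
subrepresentations, the only form in which the indecomposability proof needs them. -/
theorem IsSubrep.minus_map_mem {U : ∀ j, Submodule k ((X.reflMinus i).obj j)}
    (hU : (X.reflMinus i).IsSubrep U) {e : E} (hs : Q.src e ≠ i) (ht : Q.tgt e ≠ i)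
    {x : X.obj (Q.src e)} (hx : X.minusEquiv i hs x ∈ U (Q.src e)) :
    X.minusEquiv i ht (X.map e x) ∈ U (Q.tgt e) := by
  have h1 : (Q.reflect i).src e = Q.src e := by simp [FinQuiver.reflect, hs, ht]
  have h2 : (Q.reflect i).tgt e = Q.tgt e := by simp [FinQuiver.reflect, hs, ht]
  have := hU.map_castObj_mem e h1.symm h2 hx
  have hdif : (X.reflMinus i).map e = _ := (dif_neg ht).trans (dif_neg hs)
  have hmap : (X.reflMinus i).map e ((X.reflMinus i).castObj h1.symm (X.minusEquiv i hs x)) =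
      (Pick.negEquiv _ k (h2.trans_ne ht)).symm (X.castObj h2.symm (X.map e (X.castObj h1
        ((Pick.negEquiv _ k (h1.trans_ne hs) : X.minusObj i _ ≃ₗ[k] _)
          ((X.reflMinus i).castObj h1.symm (X.minusEquiv i hs x)))))) :=
    LinearMap.congr_fun hdif _
  rw [castObj_minusEquiv] at hmap
  rwa [hmap, castObj_negEquiv_symm_minus (hb := ht)] at this

theorem IsSubrep.minus_single_mem {U : ∀ j, Submodule k ((X.reflMinus i).obj j)}
    (hU : (X.reflMinus i).IsSubrep U) (e : {e : E // Q.src e = i}) (ht : Q.tgt e ≠ i)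
    {x : X.obj (Q.tgt e)} (hx : X.minusEquiv i ht x ∈ U (Q.tgt e)) :
    X.minusEquivSelf i ((LinearMap.range (X.outMap i)).mkQ (Pi.single e x)) ∈ U i := by
  obtain ⟨e, hs⟩ := e
  have h1 : (Q.reflect i).src e = Q.tgt e := by simp [FinQuiver.reflect, hs]
  have h2 : (Q.reflect i).tgt e = i := by simp [FinQuiver.reflect, hs]
  have := hU.map_castObj_mem e h1.symm h2 hx
  have hdif : (X.reflMinus i).map e = _ := (dif_neg ht).trans (dif_pos hs)
  have hmap : (X.reflMinus i).map e ((X.reflMinus i).castObj h1.symm (X.minusEquiv i ht x)) =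
      (Pick.posEquiv _ k h2).symm ((LinearMap.range (X.outMap i)).mkQ
        (Pi.single (M := fun e : {e : E // Q.src e = i} => X.obj (Q.tgt e)) ⟨e, hs⟩
          (X.castObj h1 ((Pick.negEquiv _ k (h1.trans_ne ht) : X.minusObj i _ ≃ₗ[k] _)
            ((X.reflMinus i).castObj h1.symm (X.minusEquiv i ht x)))))) :=
    LinearMap.congr_fun hdif _
  rw [castObj_minusEquiv] at hmap
  rwa [hmap, castObj_posEquiv_symm_minus] at this

variable [Fintype E]

theorem IsSubrep.minus_pi_mem {U : ∀ j, Submodule k ((X.reflMinus i).obj j)}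
    (hU : (X.reflMinus i).IsSubrep U) (hi : ∀ e, Q.tgt e ≠ i)
    {v : (e : {e : E // Q.src e = i}) → X.obj (Q.tgt e)}
    (hv : ∀ e : {e : E // Q.src e = i}, X.minusEquiv i (hi e) (v e) ∈ U (Q.tgt e)) :
    X.minusEquivSelf i ((LinearMap.range (X.outMap i)).mkQ v) ∈ U i := by
  rw [← Finset.univ_sum_single v, map_sum, map_sum]
  exact Submodule.sum_mem _ fun e _ => hU.minus_single_mem e (hi e) (hv e)

theorem Indecomposable.reflMinus (hX : X.Indecomposable) (hi : Q.op.IsSink i)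
    (hd : X.dimVector ≠ Pi.single i 1) : (X.reflMinus i).Indecomposable := by
  have hker := hX.outMap_injective hi hd
  have hi : ∀ e, Q.tgt e ≠ i := hi
  constructor
  · by_contra hcon
    push Not at hcon
    have hss : ∀ j, j ≠ i → Subsingleton (X.obj j) := fun j hj => by
      have := hcon j
      exact (X.minusEquiv i hj).toEquiv.subsingleton
    exact hd (hX.dimVector_eq_single (fun e _ => hi e) hss)
  intro U W hU hW hUW
  -- A decomposition of `S_i^- X` is pulled back to `X`; at `i` one takes the vectors all of whose
  -- images under the outgoing arrows lie in `U`.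
  let A : (∀ j, Submodule k ((X.reflMinus i).obj j)) → ∀ j, Submodule k (X.obj j) := fun U =>
    Function.update
      (fun j => if h : j ≠ i then (U j).comap (X.minusEquiv i h).toLinearMap else ⊥) i
      ((Submodule.pi Set.univ fun e : {e : E // Q.src e = i} =>
        (U (Q.tgt e)).comap (X.minusEquiv i (hi e)).toLinearMap).comap (X.outMap i))
  have hA_ne : ∀ U j (h : j ≠ i), A U j = (U j).comap (X.minusEquiv i h).toLinearMap :=
    fun U j h => by simp only [A, Function.update_of_ne h, dif_pos h]
  have hA_self : ∀ U (x : X.obj i), x ∈ A U i ↔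
      ∀ e : {e : E // Q.src e = i}, X.minusEquiv i (hi e) (X.outMap i x e) ∈ U (Q.tgt e) :=
    fun U x => by simp [A, Submodule.mem_pi]
  have hA : ∀ U, (X.reflMinus i).IsSubrep U → X.IsSubrep (A U) := fun U hU e x hx => by
    rw [hA_ne U _ (hi e)]
    by_cases hs : Q.src e = i
    · subst hs
      exact (hA_self U x).1 hx ⟨e, rfl⟩
    · rw [hA_ne U _ hs] at hx
      exact hU.minus_map_mem hs (hi e) hx
  have hcompl : ∀ j, IsCompl (A U j) (A W j) := fun j => by
    by_cases hj : j = i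
    · subst hj
      constructor
      · rw [Submodule.disjoint_def]
        intro x hxU hxW
        rw [hA_self] at hxU hxW
        refine LinearMap.ker_eq_bot'.1 hker x (funext fun e => ?_)
        have := Submodule.disjoint_def.1 (hUW (Q.tgt e)).disjoint _ (hxU e) (hxW e)
        exact (LinearEquiv.map_eq_zero_iff _).1 this
      · rw [codisjoint_iff, Submodule.eq_top_iff']
        intro x
        have hdec : ∀ e : {e : E // Q.src e = j}, ∃ u w : X.obj (Q.tgt e),
            X.minusEquiv j (hi e) u ∈ U (Q.tgt e) ∧ X.minusEquiv j (hi e) w ∈ W (Q.tgt e) ∧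
            u + w = X.outMap j x e := fun e => by
          have hx : X.minusEquiv j (hi e) (X.outMap j x e) ∈ U (Q.tgt e) ⊔ W (Q.tgt e) := by
            rw [(hUW _).sup_eq_top]; trivial
          obtain ⟨u, hu, w, hw, huw⟩ := Submodule.mem_sup.1 hx
          refine ⟨(X.minusEquiv j (hi e)).symm u, (X.minusEquiv j (hi e)).symm w, by simpa,
            by simpa, ?_⟩
          rw [← map_add, huw, LinearEquiv.symm_apply_apply]
        choose u w hu hw huw using hdec
        have huw' : u + w = X.outMap j x := funext huw
        -- The classes of `u` and `w` in the cokernel lie in complementary subspaces and add up to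
        -- zero, so both vanish and `u`, `w` come from vectors of `X_j`.
        have hmk : X.minusEquivSelf j ((LinearMap.range (X.outMap j)).mkQ u) +
            X.minusEquivSelf j ((LinearMap.range (X.outMap j)).mkQ w) = 0 := by
          rw [← map_add, ← map_add, huw', LinearEquiv.map_eq_zero_iff, Submodule.mkQ_apply,
            Submodule.Quotient.mk_eq_zero]
          exact ⟨x, rfl⟩
        have hu0 : X.minusEquivSelf j ((LinearMap.range (X.outMap j)).mkQ u) = 0 := by
          refine Submodule.disjoint_def.1 (hUW j).disjoint _ (hU.minus_pi_mem hi hu) ?_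
          rw [eq_neg_of_add_eq_zero_left hmk]
          exact neg_mem (hW.minus_pi_mem hi hw)
        rw [LinearEquiv.map_eq_zero_iff, Submodule.mkQ_apply,
          Submodule.Quotient.mk_eq_zero] at hu0
        obtain ⟨x', hx'⟩ := hu0
        refine Submodule.mem_sup.2 ⟨x', ?_, x - x', ?_, by abel⟩
        · rw [hA_self, hx']; exact hu
        · rw [hA_self, map_sub, hx', ← huw', add_sub_cancel_left]; exact hw
    · rw [hA_ne U j hj, hA_ne W j hj]
      exact isCompl_comap _ (hUW j)
  -- If `U` vanishes away from `i`, then `W` is everything there; the cokernel is generated from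
  -- those vertices, so `W` is everything at `i` too.
  have hzero : ∀ U W, (X.reflMinus i).IsSubrep W → (∀ j, IsCompl (U j) (W j)) →
      (∀ j, A U j = ⊥) → ∀ j, U j = ⊥ := fun U W hW hUW h => by
    have hne : ∀ j, j ≠ i → U j = ⊥ := fun j hj => by
      have := h j
      rwa [hA_ne U j hj, comap_eq_bot_iff] at this
    intro j
    by_cases hj : j = i
    · subst hj
      have htop : W j = ⊤ := by
        rw [Submodule.eq_top_iff']
        intro y
        obtain ⟨y', rfl⟩ := (X.minusEquivSelf j).surjective y
        obtain ⟨v, rfl⟩ := Submodule.mkQ_surjective _ y'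
        refine hW.minus_pi_mem hi fun e => ?_
        have := (hUW (Q.tgt e)).sup_eq_top
        rw [hne _ (hi e), bot_sup_eq] at this
        rw [this]
        trivial
      have := (hUW j).inf_eq_bot
      rwa [htop, inf_top_eq] at this
    · exact hne j hj
  rcases hX.2 _ _ (hA U hU) (hA W hW) hcompl with h | h
  · exact Or.inl (hzero U W hW hUW h)
  · exact Or.inr (hzero W U hU (fun j => (hUW j).symm) h)

theorem IsFiniteDimensional.reflMinus (hX : X.IsFiniteDimensional) :
    (X.reflMinus i).IsFiniteDimensional := fun j => by
  have := hX
  by_cases hj : j = i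
  · subst hj
    have : ∀ e, FiniteDimensional k (X.obj e) := hX
    exact (X.minusEquivSelf j).finiteDimensional
  · have := hX j
    exact (X.minusEquiv i hj).finiteDimensional

theorem Indecomposable.dimVector_reflMinus (hX : X.Indecomposable) (hf : X.IsFiniteDimensional)
    (hi : Q.op.IsSink i) (hd : X.dimVector ≠ Pi.single i 1) :
    (X.reflMinus i).dimVector = Q.reflection i X.dimVector := by
  have hker := hX.outMap_injective hi hd
  have hi : ∀ e, Q.tgt e ≠ i := hi
  have : ∀ e, FiniteDimensional k (X.obj e) := hf
  ext j
  by_cases hj : j = i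
  · subst hj
    rw [FinQuiver.reflection_apply_self]
    have h1 := (LinearMap.range (X.outMap j)).finrank_quotient_add_finrank
    rw [LinearMap.finrank_range_of_inj (LinearMap.ker_eq_bot.1 hker),
      Module.finrank_pi_fintype, (X.minusEquivSelf j).finrank_eq] at h1
    have h2 : Q.neighborSum j X.dimVector =
        ((∑ e : {e : E // Q.src e = j}, Module.finrank k (X.obj (Q.tgt e)) : ℕ) : ℤ) := by
      push_cast
      rw [FinQuiver.neighborSum, ← Finset.sum_subtype (Finset.univ.filter fun e => Q.src e = j)
        (by simp) fun e => (Module.finrank k (X.obj (Q.tgt e)) : ℤ), Finset.sum_filter]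
      exact Finset.sum_congr rfl fun e _ => by rw [if_neg (hi e), add_zero]; rfl
    rw [h2, ← h1, dimVector]
    push_cast
    simp only [dimVector]
    ring
  · rw [FinQuiver.reflection_apply_of_ne Q hj, dimVector, dimVector,
      (X.minusEquiv i hj).finrank_eq]

end Minus

end QuiverRep

namespace QuiverRep

variable {V E : Type} {k : Type u} [Field k]

/-! ### The reflection functor at a sink. -/

section Plus

variable [DecidableEq V] [Fintype E] {Q : FinQuiver V E}

theorem inMap_apply (X : QuiverRep k Q) (i : V)
    (v : (e : {e : E // Q.tgt e = i}) → X.obj (Q.src e)) :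
    X.inMap i v = ∑ e : {e : E // Q.tgt e = i}, X.castObj e.2 (X.map e (v e)) := by
  simp [inMap]

theorem inMap_single [DecidableEq E] (X : QuiverRep k Q) (e : E) (x : X.obj (Q.src e)) :
    X.inMap (Q.tgt e) (Pi.single (M := fun e' : {e' : E // Q.tgt e' = Q.tgt e} =>
      X.obj (Q.src e')) ⟨e, rfl⟩ x) = X.map e x := by
  rw [inMap_apply, Finset.sum_eq_single ⟨e, rfl⟩]
  · rw [Pi.single_eq_same]; rfl
  · intro e' _ he'
    rw [Pi.single_eq_of_ne he', map_zero, map_zero]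
  · simp

/-- Dual to the case of a source: a complement of the image splits off at `i`. -/
theorem Indecomposable.inMap_surjective {X : QuiverRep k Q} (hX : X.Indecomposable) {i : V}
    (hi : Q.IsSink i) (hd : X.dimVector ≠ Pi.single i 1) :
    LinearMap.range (X.inMap i) = ⊤ := by
  classical
  obtain ⟨L, hL⟩ := Submodule.exists_isCompl (LinearMap.range (X.inMap i))
  have hU : X.IsSubrep (Function.update (fun _ => ⊥) i L) := by
    intro e x hx
    rw [Function.update_of_ne (hi e), Submodule.mem_bot] at hx
    rw [hx, map_zero]
    exact zero_mem _
  have hW : X.IsSubrep (Function.update (fun _ => ⊤) i (LinearMap.range (X.inMap i))) := by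
    intro e x _
    by_cases ht : Q.tgt e = i
    · subst ht
      rw [Function.update_self, ← inMap_single]
      exact LinearMap.mem_range_self _ _
    · rw [Function.update_of_ne ht]
      trivial
  rcases hX.2 _ _ hU hW (isCompl_update hL.symm fun _ _ => isCompl_bot_top) with h | h
  · have hL0 : L = ⊥ := by simpa using h i
    have := hL.sup_eq_top
    rwa [hL0, sup_bot_eq] at this
  · refine absurd (hX.dimVector_eq_single (fun e he => absurd he (hi e)) fun j hj => ?_) hd
    have := h j
    rw [Function.update_of_ne hj] at this
    exact (Submodule.subsingleton_iff k).1 (subsingleton_of_bot_eq_top this.symm)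

variable (X : QuiverRep k Q) (i : V)

/-- The identification of `(S_i^+ X)_j` with `X_j`, for `j ≠ i`. -/
def plusEquiv {j : V} (h : j ≠ i) : X.obj j ≃ₗ[k] (X.reflPlus i).obj j :=
  (Pick.negEquiv (decEq j i) k h).symm

/-- The identification of `(S_i^+ X)_i` with the kernel of `inMap`. -/
def plusEquivSelf : LinearMap.ker (X.inMap i) ≃ₗ[k] (X.reflPlus i).obj i :=
  (Pick.posEquiv (decEq i i) k rfl).symm

theorem castObj_plusEquiv {a b : V} (h : a = b) (ha : a ≠ i) (hb : b ≠ i) (x : X.obj b) :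
    X.castObj h ((Pick.negEquiv (decEq a i) k ha : X.plusObj i a ≃ₗ[k] X.obj a)
      ((X.reflPlus i).castObj h.symm (X.plusEquiv i hb x))) = x := by
  subst h
  exact (Pick.negEquiv (decEq a i) k ha : X.plusObj i a ≃ₗ[k] X.obj a).apply_symm_apply x

theorem castObj_negEquiv_symm_plus {a b : V} (h : a = b) (ha : a ≠ i) (hb : b ≠ i)
    (x : X.obj b) : (X.reflPlus i).castObj h
      ((Pick.negEquiv (decEq a i) k ha).symm (X.castObj h.symm x)) = X.plusEquiv i hb x := by
  subst h; rfl

theorem posEquiv_plusEquivSelf {a : V} (h : a = i) (x : LinearMap.ker (X.inMap i)) :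
    (Pick.posEquiv (decEq a i) k h : X.plusObj i a ≃ₗ[k] _)
      ((X.reflPlus i).castObj h.symm (X.plusEquivSelf i x)) = x := by
  subst h
  exact (Pick.posEquiv (decEq a a) k rfl : X.plusObj a a ≃ₗ[k] _).apply_symm_apply x

variable {X i}

theorem IsSubrep.plus_map_mem {U : ∀ j, Submodule k ((X.reflPlus i).obj j)}
    (hU : (X.reflPlus i).IsSubrep U) {e : E} (hs : Q.src e ≠ i) (ht : Q.tgt e ≠ i)
    {x : X.obj (Q.src e)} (hx : X.plusEquiv i hs x ∈ U (Q.src e)) :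
    X.plusEquiv i ht (X.map e x) ∈ U (Q.tgt e) := by
  have h1 : (Q.reflect i).src e = Q.src e := by simp [FinQuiver.reflect, hs, ht]
  have h2 : (Q.reflect i).tgt e = Q.tgt e := by simp [FinQuiver.reflect, hs, ht]
  have := hU.map_castObj_mem e h1.symm h2 hx
  have hdif : (X.reflPlus i).map e = _ := (dif_neg hs).trans (dif_neg ht)
  have hmap : (X.reflPlus i).map e ((X.reflPlus i).castObj h1.symm (X.plusEquiv i hs x)) =
      (Pick.negEquiv _ k (h2.trans_ne ht)).symm (X.castObj h2.symm (X.map e (X.castObj h1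
        ((Pick.negEquiv _ k (h1.trans_ne hs) : X.plusObj i _ ≃ₗ[k] _)
          ((X.reflPlus i).castObj h1.symm (X.plusEquiv i hs x)))))) :=
    LinearMap.congr_fun hdif _
  rw [castObj_plusEquiv] at hmap
  rwa [hmap, castObj_negEquiv_symm_plus (hb := ht)] at this

theorem IsSubrep.plus_apply_mem {U : ∀ j, Submodule k ((X.reflPlus i).obj j)}
    (hU : (X.reflPlus i).IsSubrep U) {v : LinearMap.ker (X.inMap i)}
    (hv : X.plusEquivSelf i v ∈ U i) (e : {e : E // Q.tgt e = i}) (hs : Q.src e ≠ i) :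
    X.plusEquiv i hs (v.1 e) ∈ U (Q.src e) := by
  obtain ⟨e, ht⟩ := e
  have h1 : (Q.reflect i).src e = i := by simp [FinQuiver.reflect, ht]
  have h2 : (Q.reflect i).tgt e = Q.src e := by simp [FinQuiver.reflect, ht]
  have := hU.map_castObj_mem e h1.symm h2 hv
  have hdif : (X.reflPlus i).map e = _ := (dif_neg hs).trans (dif_pos ht)
  have hmap : (X.reflPlus i).map e ((X.reflPlus i).castObj h1.symm (X.plusEquivSelf i v)) =
      (Pick.negEquiv _ k (h2.trans_ne hs)).symm (X.castObj h2.symm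
        (((Pick.posEquiv _ k h1 : X.plusObj i _ ≃ₗ[k] LinearMap.ker (X.inMap i))
          ((X.reflPlus i).castObj h1.symm (X.plusEquivSelf i v))).1 ⟨e, ht⟩)) :=
    LinearMap.congr_fun hdif _
  rw [posEquiv_plusEquivSelf] at hmap
  rwa [hmap, castObj_negEquiv_symm_plus (hb := hs)] at this

theorem Indecomposable.reflPlus (hX : X.Indecomposable) (hi : Q.IsSink i)
    (hd : X.dimVector ≠ Pi.single i 1) : (X.reflPlus i).Indecomposable := by
  classical
  have hrange := hX.inMap_surjective hi hd
  constructor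
  · by_contra hcon
    push Not at hcon
    have hss : ∀ j, j ≠ i → Subsingleton (X.obj j) := fun j hj => by
      have := hcon j
      exact (X.plusEquiv i hj).toEquiv.subsingleton
    exact hd (hX.dimVector_eq_single (fun e he => absurd he (hi e)) hss)
  intro U W hU hW hUW
  -- At the sink `i` one takes the subspace generated by the images of the `U`-parts under the
  -- incoming arrows.
  let A : (∀ j, Submodule k ((X.reflPlus i).obj j)) → ∀ j, Submodule k (X.obj j) := fun U =>
    Function.update
      (fun j => if h : j ≠ i then (U j).comap (X.plusEquiv i h).toLinearMap else ⊥) i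
      ((Submodule.pi Set.univ fun e : {e : E // Q.tgt e = i} =>
        (U (Q.src e)).comap (X.plusEquiv i (hi e)).toLinearMap).map (X.inMap i))
  have hA_ne : ∀ U j (h : j ≠ i), A U j = (U j).comap (X.plusEquiv i h).toLinearMap :=
    fun U j h => by simp only [A, Function.update_of_ne h, dif_pos h]
  have hA_self : ∀ U (x : X.obj i), x ∈ A U i ↔
      ∃ v, (∀ e : {e : E // Q.tgt e = i}, X.plusEquiv i (hi e) (v e) ∈ U (Q.src e)) ∧
        X.inMap i v = x :=
    fun U x => by simp [A, Submodule.mem_pi, Submodule.mem_map]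
  have hA : ∀ U, (X.reflPlus i).IsSubrep U → X.IsSubrep (A U) := fun U hU e x hx => by
    rw [hA_ne U _ (hi e)] at hx
    by_cases ht : Q.tgt e = i
    · subst ht
      rw [hA_self]
      refine ⟨_, fun e' => ?_, X.inMap_single e x⟩
      by_cases he : e' = ⟨e, rfl⟩
      · subst he; rw [Pi.single_eq_same]; exact hx
      · rw [Pi.single_eq_of_ne he, map_zero]; exact zero_mem _
    · rw [hA_ne U _ ht]
      exact hU.plus_map_mem (hi e) ht hx
  have hcompl : ∀ j, IsCompl (A U j) (A W j) := fun j => by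
    by_cases hj : j = i
    · subst hj
      constructor
      · rw [Submodule.disjoint_def]
        intro x hxU hxW
        obtain ⟨u, hu, hux⟩ := (hA_self U x).1 hxU
        obtain ⟨w, hw, hwx⟩ := (hA_self W x).1 hxW
        -- Decompose `u - w = a + b` in the kernel. Componentwise `u - a = w + b` lies in both `U`
        -- and `W`, so `u = a` is in the kernel and the common image is zero.
        have hker : u - w ∈ LinearMap.ker (X.inMap j) := by
          rw [LinearMap.mem_ker, map_sub, hux, hwx, sub_self]
        have hmem : X.plusEquivSelf j ⟨u - w, hker⟩ ∈ U j ⊔ W j := by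
          rw [(hUW _).sup_eq_top]; trivial
        obtain ⟨a, ha, b, hb, hab⟩ := Submodule.mem_sup.1 hmem
        obtain ⟨a, rfl⟩ := (X.plusEquivSelf j).surjective a
        obtain ⟨b, rfl⟩ := (X.plusEquivSelf j).surjective b
        rw [← map_add] at hab
        have hab : a.1 + b.1 = u - w :=
          congrArg Subtype.val ((X.plusEquivSelf j).injective hab)
        have hua : u = a.1 := by
          funext e
          have hU' := hU.plus_apply_mem ha e (hi e)
          have hW' := hW.plus_apply_mem hb e (hi e)
          have hab' : u e - a.1 e = w e + b.1 e := by
            have : a.1 e + b.1 e = u e - w e := congrFun hab e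
            rw [sub_eq_iff_eq_add, add_assoc, add_comm (b.1 e), this]
            abel
          have h1 : X.plusEquiv j (hi e) (u e - a.1 e) ∈ U (Q.src e) := by
            rw [map_sub]; exact sub_mem (hu e) hU'
          have h2 : X.plusEquiv j (hi e) (u e - a.1 e) ∈ W (Q.src e) := by
            rw [hab', map_add]; exact add_mem (hw e) hW'
          have := Submodule.disjoint_def.1 (hUW (Q.src e)).disjoint _ h1 h2
          exact sub_eq_zero.1 ((LinearEquiv.map_eq_zero_iff _).1 this)
        rw [← hux, hua]
        exact a.2
      · rw [codisjoint_iff, Submodule.eq_top_iff']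
        intro x
        obtain ⟨v, rfl⟩ := LinearMap.range_eq_top.1 hrange x
        have hdec : ∀ e : {e : E // Q.tgt e = j}, ∃ u w : X.obj (Q.src e),
            X.plusEquiv j (hi e) u ∈ U (Q.src e) ∧ X.plusEquiv j (hi e) w ∈ W (Q.src e) ∧
            u + w = v e := fun e => by
          have hx : X.plusEquiv j (hi e) (v e) ∈ U (Q.src e) ⊔ W (Q.src e) := by
            rw [(hUW _).sup_eq_top]; trivial
          obtain ⟨u, hu, w, hw, huw⟩ := Submodule.mem_sup.1 hx
          refine ⟨(X.plusEquiv j (hi e)).symm u, (X.plusEquiv j (hi e)).symm w, by simpa,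
            by simpa, ?_⟩
          rw [← map_add, huw, LinearEquiv.symm_apply_apply]
        choose u w hu hw huw using hdec
        refine Submodule.mem_sup.2 ⟨X.inMap j u, (hA_self U _).2 ⟨u, hu, rfl⟩, X.inMap j w,
          (hA_self W _).2 ⟨w, hw, rfl⟩, ?_⟩
        rw [← map_add, show u + w = v from funext huw]
    · rw [hA_ne U j hj, hA_ne W j hj]
      exact isCompl_comap _ (hUW j)
  -- The kernel embeds into the product of the spaces at neighbouring vertices, so a
  -- subrepresentation that vanishes there vanishes at `i`.
  have hzero : ∀ U, (X.reflPlus i).IsSubrep U → (∀ j, A U j = ⊥) → ∀ j, U j = ⊥ :=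
    fun U hU h => by
      have hne : ∀ j, j ≠ i → U j = ⊥ := fun j hj => by
        have := h j
        rwa [hA_ne U j hj, comap_eq_bot_iff] at this
      intro j
      by_cases hj : j = i
      · subst hj
        rw [Submodule.eq_bot_iff]
        intro y hy
        obtain ⟨v, rfl⟩ := (X.plusEquivSelf j).surjective y
        rw [LinearEquiv.map_eq_zero_iff]
        refine Subtype.ext (funext fun e => ?_)
        have := hU.plus_apply_mem hy e (hi e)
        rw [hne _ (hi e), Submodule.mem_bot, LinearEquiv.map_eq_zero_iff] at this
        exact this
      · exact hne j hj
  rcases hX.2 _ _ (hA U hU) (hA W hW) hcompl with h | h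
  · exact Or.inl (hzero U hU h)
  · exact Or.inr (hzero W hW h)

theorem IsFiniteDimensional.reflPlus (hX : X.IsFiniteDimensional) :
    (X.reflPlus i).IsFiniteDimensional := fun j => by
  have : ∀ e, FiniteDimensional k (X.obj e) := hX
  by_cases hj : j = i
  · subst hj
    exact (X.plusEquivSelf j).finiteDimensional
  · exact (X.plusEquiv i hj).finiteDimensional

theorem Indecomposable.dimVector_reflPlus (hX : X.Indecomposable) (hf : X.IsFiniteDimensional)
    (hi : Q.IsSink i) (hd : X.dimVector ≠ Pi.single i 1) :
    (X.reflPlus i).dimVector = Q.reflection i X.dimVector := by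
  have hrange := hX.inMap_surjective hi hd
  have : ∀ e, FiniteDimensional k (X.obj e) := hf
  ext j
  by_cases hj : j = i
  · subst hj
    rw [FinQuiver.reflection_apply_self]
    have h1 := (X.inMap j).finrank_range_add_finrank_ker
    rw [hrange, finrank_top, Module.finrank_pi_fintype, (X.plusEquivSelf j).finrank_eq] at h1
    have h2 : Q.neighborSum j X.dimVector =
        ((∑ e : {e : E // Q.tgt e = j}, Module.finrank k (X.obj (Q.src e)) : ℕ) : ℤ) := by
      push_cast
      rw [FinQuiver.neighborSum, ← Finset.sum_subtype (Finset.univ.filter fun e => Q.tgt e = j)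
        (by simp) fun e => (Module.finrank k (X.obj (Q.src e)) : ℤ), Finset.sum_filter]
      exact Finset.sum_congr rfl fun e _ => by rw [if_neg (hi e), zero_add]; rfl
    rw [h2, ← h1, dimVector]
    push_cast
    simp only [dimVector]
    ring
  · rw [FinQuiver.reflection_apply_of_ne Q hj, dimVector, dimVector,
      (X.plusEquiv i hj).finrank_eq]

end Plus

/-! ### Coxeter functors on unobstructed indecomposables. -/

section Coxeter

variable {Q : FinQuiver V E}

/-- A finite dimensional indecomposable representation with dimension vector `x`. -/
structure IsIndecOfDim (X : QuiverRep k Q) (x : V → ℤ) : Prop where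
  indecomposable : X.Indecomposable
  finiteDimensional : X.IsFiniteDimensional
  dimVector_eq : X.dimVector = x

theorem IsIndecOfDim.castQuiver {Q' : FinQuiver V E} (h : Q = Q') {X : QuiverRep k Q}
    {x : V → ℤ} (hX : X.IsIndecOfDim x) : (castQuiver h X).IsIndecOfDim x := by
  subst h; exact hX

variable [DecidableEq V] [Fintype E]

theorem IsIndecOfDim.plusList {X : QuiverRep k Q} {x : V → ℤ} (hX : X.IsIndecOfDim x)
    {l : List V} (hl : Q.SinkSequence l) (ha : Q.AvoidsSimple l x) :
    (X.plusList l).IsIndecOfDim (Q.reflectionList l x) := by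
  induction l generalizing Q x with
  | nil => exact hX
  | cons i l ih =>
    obtain ⟨h1, h2, rfl⟩ := hX
    have := ih (X := X.reflPlus i) (x := Q.reflection i X.dimVector)
      ⟨h1.reflPlus hl.1 ha.1, h2.reflPlus, h1.dimVector_reflPlus h2 hl.1 ha.1⟩ hl.2
      ((FinQuiver.avoidsSimple_congr (Q.reflection_reflect i) l _).2 ha.2)
    rw [FinQuiver.reflectionList_reflect] at this
    exact this

theorem IsIndecOfDim.iterate_coxPlus {o : Q.AdmissibleOrdering} {X : QuiverRep k Q}
    {x : V → ℤ} (hX : X.IsIndecOfDim x)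
    (ha : ∀ r, Q.AvoidsSimple o.list ((Q.reflectionList o.list)^[r] x)) (r : ℕ) :
    ((coxPlus o)^[r] X).IsIndecOfDim ((Q.reflectionList o.list)^[r] x) := by
  induction r with
  | zero => exact hX
  | succ r ih =>
    rw [Function.iterate_succ_apply', Function.iterate_succ_apply']
    exact (ih.plusList o.sinks (ha r)).castQuiver _

variable [DecidableEq E]

theorem IsIndecOfDim.minusList {X : QuiverRep k Q} {x : V → ℤ} (hX : X.IsIndecOfDim x)
    {l : List V} (hl : Q.op.SinkSequence l) (ha : Q.AvoidsSimple l x) :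
    (X.minusList l).IsIndecOfDim (Q.reflectionList l x) := by
  induction l generalizing Q x with
  | nil => exact hX
  | cons i l ih =>
    obtain ⟨h1, h2, rfl⟩ := hX
    obtain ⟨hl1, hl2⟩ := hl
    rw [FinQuiver.op_reflect] at hl2
    have := ih (X := X.reflMinus i) (x := Q.reflection i X.dimVector)
      ⟨h1.reflMinus hl1 ha.1, h2.reflMinus, h1.dimVector_reflMinus h2 hl1 ha.1⟩ hl2
      ((FinQuiver.avoidsSimple_congr (Q.reflection_reflect i) l _).2 ha.2)
    rw [FinQuiver.reflectionList_reflect] at this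
    exact this

theorem IsIndecOfDim.iterate_coxMinus {o : Q.AdmissibleOrdering} {X : QuiverRep k Q}
    {x : V → ℤ} (hX : X.IsIndecOfDim x)
    (ha : ∀ r, Q.AvoidsSimple o.list.reverse ((Q.reflectionList o.list.reverse)^[r] x))
    (r : ℕ) :
    ((coxMinus o)^[r] X).IsIndecOfDim ((Q.reflectionList o.list.reverse)^[r] x) := by
  have hs := o.sinks.op_reverse
  rw [Q.reflectList_eq_self o.list o.nodup o.mem] at hs
  induction r with
  | zero => exact hX
  | succ r ih =>
    rw [Function.iterate_succ_apply', Function.iterate_succ_apply']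
    exact (ih.minusList hs (ha r)).castQuiver _

end Coxeter

end QuiverRep

/-! ### Counting paths: admissible orderings and the inverse of the Euler matrix. -/

namespace FinQuiver

variable {V E : Type} {Q : FinQuiver V E}

/-- The last arrow of a path. -/
noncomputable def Path.lastArrow (Q : FinQuiver V E) {a b : V} (p : Q.Path a b) : Option E :=
  @Quiver.Path.rec V Q.toQuiver a (fun _ _ => Option E) none (fun _ e _ => some e.1) b p

/-- A path is trivial, or it is obtained by prolonging a path by an arrow. -/
def Path.ofSum (Q : FinQuiver V E) (a b : V) :
    PLift (a = b) ⊕ (Σ e : {e : E // Q.tgt e = b}, Q.Path a (Q.src e)) → Q.Path a b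
  | Sum.inl h => h.down ▸ @Quiver.Path.nil V Q.toQuiver a
  | Sum.inr ⟨e, p⟩ => @Quiver.Path.cons V Q.toQuiver a (Q.src e) b p ⟨e, rfl, e.2⟩

theorem Path.ofSum_bijective (Q : FinQuiver V E) (a b : V) :
    Function.Bijective (Path.ofSum Q a b) := by
  have hnil : ∀ h : PLift (a = b), Path.lastArrow Q (Path.ofSum Q a b (Sum.inl h)) = none := by
    rintro ⟨rfl⟩; rfl
  constructor
  · rintro (h | ⟨⟨e, he⟩, p⟩) (h' | ⟨⟨e', he'⟩, p'⟩) hpp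
    · exact congrArg _ (Subsingleton.elim _ _)
    · have := congrArg (Path.lastArrow Q) hpp
      rw [hnil] at this
      cases this
    · have := congrArg (Path.lastArrow Q) hpp
      rw [hnil] at this
      cases this
    · obtain rfl : e = e' := Option.some.inj (congrArg (Path.lastArrow Q) hpp)
      obtain rfl : p = p' := eq_of_heq (Quiver.Path.cons.inj hpp).2.1
      rfl
  · intro p
    cases p with
    | nil => exact ⟨Sum.inl ⟨rfl⟩, rfl⟩
    | cons p e =>
      obtain ⟨e, rfl, he⟩ := e
      exact ⟨Sum.inr ⟨⟨e, he⟩, p⟩, rfl⟩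

/-- The number of vertices from which there is a path to `b`. -/
noncomputable def depth (Q : FinQuiver V E) (b : V) : ℕ := {a | Nonempty (Q.Path a b)}.ncard

/-- The target of `e` is a new predecessor of itself: a path from it back to the source would close
an oriented cycle. -/
theorem NoOrientedCycles.depth_lt [Finite V] (hQ : Q.NoOrientedCycles) (e : E) :
    Q.depth (Q.src e) < Q.depth (Q.tgt e) := by
  refine Set.ncard_lt_ncard (Set.ssubset_iff_exists.2 ⟨?_, Q.tgt e, ?_, ?_⟩) (Set.toFinite _)
  · rintro a ⟨p⟩
    exact ⟨Path.snoc Q e p⟩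
  · exact ⟨@Quiver.Path.nil V Q.toQuiver _⟩
  · rintro ⟨p⟩
    exact nomatch hQ _ (Path.snoc Q e p)

theorem NoOrientedCycles.loopless [Finite V] (hQ : Q.NoOrientedCycles) : Q.Loopless :=
  fun e he => (hQ.depth_lt e).ne (congrArg _ he)

theorem NoOrientedCycles.finite_path [Finite V] [Finite E] (hQ : Q.NoOrientedCycles)
    (a b : V) : Finite (Q.Path a b) := by
  induction hn : Q.depth b using Nat.strong_induction_on generalizing b with
  | _ n ih =>
    have : ∀ e : {e : E // Q.tgt e = b}, Finite (Q.Path a (Q.src e)) := by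
      rintro ⟨e, rfl⟩
      exact ih _ (hn ▸ hQ.depth_lt e) _ rfl
    exact Finite.of_surjective _ (Path.ofSum_bijective Q a b).surjective

/-- The invariant `h` survives a reflection at the head, because the reversed arrows now start at a
vertex outside the remaining list. It makes the head, where `d` is maximal, a sink. -/
theorem sinkSequence_of_depth [DecidableEq V] (d : V → ℕ) (Q : FinQuiver V E) (l : List V)
    (hl : l.Nodup) (hs : l.Pairwise fun a b => d b ≤ d a)
    (h : ∀ e, Q.src e ∈ l → Q.tgt e ∈ l ∧ d (Q.src e) < d (Q.tgt e)) : Q.SinkSequence l := by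
  induction l generalizing Q with
  | nil => trivial
  | cons i l ih =>
    rw [List.nodup_cons] at hl
    rw [List.pairwise_cons] at hs
    have hi : Q.IsSink i := fun e he => by
      obtain ⟨h1, h2⟩ := h e (by rw [he]; exact List.mem_cons_self)
      rw [he] at h2
      rcases List.mem_cons.1 h1 with h1 | h1
      · exact h2.ne (by rw [h1])
      · exact absurd (hs.1 _ h1) (not_le.2 h2)
    refine ⟨hi, ih _ hl.2 hs.2 fun e he => ?_⟩
    have hs' := hi e
    by_cases ht : Q.tgt e = i
    · simp only [reflect, ht, or_true, if_true] at he
      exact absurd he hl.1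
    · simp only [reflect, hs', ht, or_false, if_false] at he ⊢
      obtain ⟨h1, h2⟩ := h e (List.mem_cons_of_mem _ he)
      exact ⟨(List.mem_cons.1 h1).resolve_left ht, h2⟩

theorem NoOrientedCycles.nonempty_admissibleOrdering [Fintype V] [DecidableEq V]
    (hQ : Q.NoOrientedCycles) : Nonempty Q.AdmissibleOrdering := by
  classical
  let r : V → V → Prop := fun a b => Q.depth b ≤ Q.depth a
  have : Std.Total r := ⟨fun a b => le_total _ _⟩
  have : IsTrans V r := ⟨fun a b c hab hbc => le_trans hbc hab⟩
  let l := (Finset.univ : Finset V).toList.insertionSort r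
  have hperm := List.perm_insertionSort r (Finset.univ : Finset V).toList
  have hmem : ∀ v, v ∈ l := fun v => hperm.mem_iff.2 (by simp)
  have hnodup : l.Nodup := hperm.nodup_iff.2 (Finset.nodup_toList _)
  exact ⟨⟨l, hnodup, hmem, sinkSequence_of_depth Q.depth Q l hnodup
    (List.pairwise_insertionSort r _) fun e _ => ⟨hmem _, hQ.depth_lt e⟩⟩⟩

/-- The matrix whose entry at `(a, b)` is the number of paths from `a` to `b`. -/
noncomputable def pathMatrix (Q : FinQuiver V E) : Matrix V V ℤ :=
  fun a b => (Nat.card (Q.Path a b) : ℤ)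

variable [Fintype V] [DecidableEq V] [Fintype E]

/-- A path is either trivial or determined by its last arrow and the path before it. Rows and
columns of the path matrix, the dimension vectors of `P(i)` and `I(i)`, thereby become dual to the
coordinates for the Euler form. -/
theorem NoOrientedCycles.pathMatrix_mul (hQ : Q.NoOrientedCycles) :
    Q.pathMatrix * (1 - Q.arrowMatrix) = 1 := by
  rw [mul_sub, mul_one, sub_eq_iff_eq_add]
  ext a b
  have := hQ.finite_path
  have hcard := Nat.card_congr (Equiv.ofBijective _ (Path.ofSum_bijective Q a b))
  rw [Nat.card_sum, Nat.card_sigma] at hcard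
  have h1 : (Nat.card (PLift (a = b)) : ℤ) = (1 : Matrix V V ℤ) a b := by
    by_cases h : a = b
    · subst h
      have : Unique (PLift (a = a)) := ⟨⟨⟨rfl⟩⟩, fun _ => Subsingleton.elim _ _⟩
      simp
    · have : IsEmpty (PLift (a = b)) := ⟨fun h' => h h'.down⟩
      simp [h]
  have h2 : (∑ e : {e : E // Q.tgt e = b}, (Nat.card (Q.Path a (Q.src e)) : ℤ)) =
      (Q.pathMatrix * Q.arrowMatrix) a b := by
    rw [← Finset.sum_subtype (Finset.univ.filter fun e => Q.tgt e = b) (by simp)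
      fun e => (Nat.card (Q.Path a (Q.src e)) : ℤ), Finset.sum_filter, arrowMatrix,
      Matrix.mul_sum, Matrix.sum_apply]
    refine Finset.sum_congr rfl fun e _ => ?_
    by_cases h : Q.tgt e = b
    · subst h; simp [pathMatrix]
    · rw [if_neg h, Matrix.mul_single_apply_of_ne _ _ _ _ _ (Ne.symm h)]
  rw [Matrix.add_apply, ← h1, ← h2, pathMatrix, ← hcard]
  push_cast
  rfl

theorem NoOrientedCycles.eulerForm_row (hQ : Q.NoOrientedCycles) (i : V) (y : V → ℤ) :
    Q.eulerForm (fun j => Q.pathMatrix i j) y = y i := by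
  rw [eulerForm_eq_dotProduct, Matrix.dotProduct_mulVec]
  have h : Matrix.vecMul (fun j => Q.pathMatrix i j) (1 - Q.arrowMatrix) = Pi.single i 1 := by
    ext j
    have := congrFun (congrFun hQ.pathMatrix_mul i) j
    rw [Matrix.one_apply] at this
    rw [Pi.single_apply]
    simp only [eq_comm (a := j)]
    exact this
  rw [h, single_one_dotProduct]

theorem NoOrientedCycles.eulerForm_column (hQ : Q.NoOrientedCycles) (i : V) (y : V → ℤ) :
    Q.eulerForm y (fun j => Q.pathMatrix j i) = y i := by
  rw [eulerForm_eq_dotProduct]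
  have hcomm : (1 - Q.arrowMatrix) * Q.pathMatrix = 1 := mul_eq_one_comm.1 hQ.pathMatrix_mul
  have h : Matrix.mulVec (1 - Q.arrowMatrix) (fun j => Q.pathMatrix j i) = Pi.single i 1 := by
    ext j
    have := congrFun (congrFun hcomm j) i
    rw [Matrix.one_apply] at this
    rw [Pi.single_apply]
    exact this
  rw [h, dotProduct_single_one]

theorem NoOrientedCycles.coxeterDatum (hQ : Q.NoOrientedCycles) {δ : V → ℤ}
    (hδ : Q.IsEuclidean δ) (o : Q.AdmissibleOrdering) :
    Q.CoxeterDatum δ o.list (fun i j => Q.pathMatrix i j) (fun i j => Q.pathMatrix j i) where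
  isEuclidean := hδ
  nodup := o.nodup
  mem := o.mem
  sinks := o.sinks
  eulerForm_p := hQ.eulerForm_row
  eulerForm_h := hQ.eulerForm_column
  p_nonneg _ _ := Nat.cast_nonneg _
  h_nonneg _ _ := Nat.cast_nonneg _

end FinQuiver

/-! ### Indecomposability and dimension vectors of `P(i)` and `I(i)`. -/

namespace QuiverRep

variable {V E : Type} {k : Type u} [Field k] {Q : FinQuiver V E}

theorem IsSubrep.single_path_mem {i : V} {U : ∀ j, Submodule k ((proj k Q i).obj j)}
    (hU : (proj k Q i).IsSubrep U)
    (h : Finsupp.single (@Quiver.Path.nil V Q.toQuiver i) (1 : k) ∈ U i) {j : V}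
    (p : Q.Path i j) : Finsupp.single p (1 : k) ∈ U j := by
  induction p with
  | nil => exact h
  | cons p e ih =>
    obtain ⟨e, rfl, rfl⟩ := e
    have := hU e _ ih
    rwa [show (proj k Q i).map e (Finsupp.single p 1) =
      Finsupp.single (FinQuiver.Path.snoc Q e p) (1 : k) from Finsupp.mapDomain_single] at this

theorem IsSubrep.proj_eq_top {i : V} {U : ∀ j, Submodule k ((proj k Q i).obj j)}
    (hU : (proj k Q i).IsSubrep U)
    (h : Finsupp.single (@Quiver.Path.nil V Q.toQuiver i) (1 : k) ∈ U i) (j : V) :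
    U j = ⊤ := by
  rw [Submodule.eq_top_iff']
  intro x
  rw [← show Finsupp.sum (M := k) x (fun p a => a • Finsupp.single p (1 : k)) = x by
    simp only [Finsupp.smul_single, smul_eq_mul, mul_one]
    exact Finsupp.sum_single x]
  exact Submodule.sum_mem _ fun p _ => Submodule.smul_mem _ _ (hU.single_path_mem h p)

/-- The trivial path generates `P(i)`, and the space at `i` is a line, so one of two complementary
subrepresentations contains the generator. -/
theorem isIndecOfDim_proj [Finite V] [Finite E] (hQ : Q.NoOrientedCycles) (i : V) :
    (proj k Q i).IsIndecOfDim (fun j => Q.pathMatrix i j) := by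
  have := hQ.finite_path
  have hrank : ∀ j, Module.finrank k ((proj k Q i).obj j) = Nat.card (Q.Path i j) := fun j => by
    have := Fintype.ofFinite (Q.Path i j)
    change Module.finrank k (Q.Path i j →₀ k) = _
    rw [Module.finrank_finsupp_self, Nat.card_eq_fintype_card]
  have hone : Module.finrank k ((proj k Q i).obj i) = 1 := by
    have : Unique (Q.Path i i) := ⟨⟨@Quiver.Path.nil V Q.toQuiver i⟩, hQ i⟩
    rw [hrank, Nat.card_unique]
  have htop : ∀ U W : ∀ j, Submodule k ((proj k Q i).obj j), (proj k Q i).IsSubrep U →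
      (∀ j, IsCompl (U j) (W j)) → U i = ⊤ → ∀ j, W j = ⊥ := fun U W hU hUW h j => by
    have := (hUW j).inf_eq_bot
    rwa [hU.proj_eq_top (by rw [h]; trivial) j, top_inf_eq] at this
  refine ⟨⟨⟨i, Module.nontrivial_of_finrank_pos (R := k) (by omega)⟩,
    fun U W hU hW hUW => ?_⟩, fun j => ?_, ?_⟩
  · have : IsSimpleOrder (Submodule k ((proj k Q i).obj i)) :=
      (isSimpleModule_iff k _).1 (isSimpleModule_iff_finrank_eq_one.2 hone)
    rcases eq_bot_or_eq_top (U i) with h | h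
    · refine Or.inl (htop W U hW (fun j => (hUW j).symm) ?_)
      have := (hUW i).sup_eq_top
      rwa [h, bot_sup_eq] at this
    · exact Or.inr (htop U W hU hUW h)
  · exact inferInstanceAs (FiniteDimensional k (Q.Path i j →₀ k))
  · ext j
    exact congrArg Nat.cast (hrank j)

/-- Precomposition of a functional on the paths that end at `i` with a path. -/
noncomputable def injTranslate (k : Type u) [Field k] (Q : FinQuiver V E) {i j m : V}
    (p : Q.Path j m) : (inj k Q i).obj j →ₗ[k] (inj k Q i).obj m :=
  (Finsupp.lmapDomain k k fun q : Q.Path m i => @Quiver.Path.comp V Q.toQuiver j m i p q).dualMap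

theorem injTranslate_apply {i j m : V} (p : Q.Path j m) (x : Module.Dual k (Q.Path j i →₀ k))
    (q : Q.Path m i) :
    (show Module.Dual k (Q.Path m i →₀ k) from injTranslate k Q p x) (Finsupp.single q 1) =
      x (Finsupp.single (@Quiver.Path.comp V Q.toQuiver j m i p q) 1) :=
  congrArg x Finsupp.mapDomain_single

theorem IsSubrep.injTranslate_mem {i : V} {U : ∀ j, Submodule k ((inj k Q i).obj j)}
    (hU : (inj k Q i).IsSubrep U) {j m : V} (p : Q.Path j m) {x : (inj k Q i).obj j}
    (hx : x ∈ U j) : injTranslate k Q p x ∈ U m := by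
  induction p with
  | nil =>
    convert hx using 1
    refine Finsupp.lhom_ext' fun q => LinearMap.ext_ring ?_
    refine (injTranslate_apply _ x q).trans ?_
    rw [@Quiver.Path.nil_comp V Q.toQuiver]
    rfl
  | cons p e ih =>
    obtain ⟨e, rfl, rfl⟩ := e
    convert hU e _ ih using 1
    refine Finsupp.lhom_ext' fun q => LinearMap.ext_ring ?_
    refine (injTranslate_apply _ x q).trans ?_
    have hmap : Finsupp.mapDomain (FinQuiver.Path.precede Q e) (Finsupp.single q (1 : k)) =
        Finsupp.single (FinQuiver.Path.precede Q e q) 1 := Finsupp.mapDomain_single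
    refine Eq.trans ?_ (congrArg (DFunLike.coe (F := Module.Dual k (Q.Path _ i →₀ k))
      (injTranslate k Q p x)) hmap).symm
    refine Eq.trans ?_ (injTranslate_apply p x _).symm
    rw [FinQuiver.Path.precede, ← @Quiver.Path.comp_assoc V Q.toQuiver]
    rfl

/-- The value of a functional on a path `p` is the value of its translate along `p` on the trivial
path at `i`. So a non-zero subrepresentation of `I(i)` is non-zero at `i`. -/
theorem IsSubrep.inj_eq_bot {i : V} {U : ∀ j, Submodule k ((inj k Q i).obj j)}
    (hU : (inj k Q i).IsSubrep U) (h : U i = ⊥) (j : V) : U j = ⊥ := by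
  rw [Submodule.eq_bot_iff]
  intro x hx
  refine Finsupp.lhom_ext' fun p => LinearMap.ext_ring ?_
  have hp := hU.injTranslate_mem p hx
  rw [h, Submodule.mem_bot] at hp
  have := injTranslate_apply p x (@Quiver.Path.nil V Q.toQuiver i)
  rw [@Quiver.Path.comp_nil V Q.toQuiver, hp] at this
  exact this.symm

theorem isIndecOfDim_inj [Finite V] [Finite E] (hQ : Q.NoOrientedCycles) (i : V) :
    (inj k Q i).IsIndecOfDim (fun j => Q.pathMatrix j i) := by
  have := hQ.finite_path
  have hrank : ∀ j, Module.finrank k ((inj k Q i).obj j) = Nat.card (Q.Path j i) := fun j => by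
    have := Fintype.ofFinite (Q.Path j i)
    change Module.finrank k (Module.Dual k (Q.Path j i →₀ k)) = _
    rw [Subspace.dual_finrank_eq, Module.finrank_finsupp_self, Nat.card_eq_fintype_card]
  have hone : Module.finrank k ((inj k Q i).obj i) = 1 := by
    have : Unique (Q.Path i i) := ⟨⟨@Quiver.Path.nil V Q.toQuiver i⟩, hQ i⟩
    rw [hrank, Nat.card_unique]
  refine ⟨⟨⟨i, Module.nontrivial_of_finrank_pos (R := k) (by omega)⟩,
    fun U W hU hW hUW => ?_⟩, fun j => ?_, ?_⟩
  · by_cases hne : U i = ⊥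
    · exact Or.inl (hU.inj_eq_bot hne)
    · refine Or.inr (hW.inj_eq_bot ?_)
      have : IsSimpleOrder (Submodule k ((inj k Q i).obj i)) :=
        (isSimpleModule_iff k _).1 (isSimpleModule_iff_finrank_eq_one.2 hone)
      have := (hUW i).inf_eq_bot
      rwa [(eq_bot_or_eq_top (U i)).resolve_left hne, top_inf_eq] at this
  · exact inferInstanceAs (FiniteDimensional k (Module.Dual k (Q.Path j i →₀ k)))
  · ext j
    exact congrArg Nat.cast (hrank j)

end QuiverRep

/-! ### Radical vector and connectedness of the Euclidean diagrams. -/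

namespace EuclideanDiagram

/-- The contribution of an edge to the sum of the marks of the neighbours of `v`. -/
def edgeMark (T : EuclideanDiagram) (v : ℕ) : Sym2 ℕ → ℤ :=
  Sym2.lift ⟨fun a b => (if a = v then T.delta b else 0) + if b = v then T.delta a else 0,
    fun _ _ => add_comm _ _⟩

theorem edgeMark_mk (T : EuclideanDiagram) (v a b : ℕ) :
    T.edgeMark v s(a, b) = (if a = v then T.delta b else 0) + if b = v then T.delta a else 0 :=
  rfl

theorem delta_pos (T : EuclideanDiagram) {v : ℕ} (hv : v < T.card) : 0 < T.delta v := by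
  cases T with
  | A m => exact one_pos
  | D m hm => simp only [delta]; split_ifs <;> norm_num
  | E6 => simp only [card] at hv; interval_cases v <;> decide
  | E7 => simp only [card] at hv; interval_cases v <;> decide
  | E8 => simp only [card] at hv; interval_cases v <;> decide

theorem sum_map_range (n : ℕ) (g : ℕ → ℤ) :
    ((List.range n).map g).sum = ∑ i ∈ Finset.range n, g i := rfl

theorem sum_edgeMark_A (m : ℕ) {v : ℕ} (hv : v < m + 1) :
    ((A m).edges.map fun p => (A m).edgeMark v s(p.1, p.2)).sum = 2 * (A m).delta v := by
  simp only [edges, List.map_map, Function.comp_def, edgeMark_mk, delta]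
  rw [sum_map_range, Finset.sum_add_distrib]
  have h1 : ∑ i ∈ Finset.range (m + 1), (if i = v then (1 : ℤ) else 0) = 1 := by
    rw [Finset.sum_ite_eq', if_pos (Finset.mem_range.2 hv)]
  -- A cyclic shift of the previous sum: the last index wraps around to `0`. For `m = 0` the loop is
  -- counted twice, as it should be.
  have h2 : ∑ i ∈ Finset.range (m + 1), (if (i + 1) % (m + 1) = v then (1 : ℤ) else 0) = 1 := by
    refine Eq.trans ?_ h1
    rw [Finset.sum_range_succ, Finset.sum_range_succ', Nat.mod_self]
    congr 1
    refine Finset.sum_congr rfl fun i hi => ?_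
    rw [Nat.mod_eq_of_lt (by simpa using hi)]
  rw [h1, h2, mul_one]
  norm_num

theorem sum_ite_add_eq (N c v : ℕ) (g : ℕ → ℤ) :
    (∑ i ∈ Finset.range N, if i + c = v + c then g i else 0) = if v < N then g v else 0 := by
  simp only [Nat.add_right_cancel_iff, Finset.sum_ite_eq', Finset.mem_range]

theorem sum_edgeMark_D (m : ℕ) (hm : 4 ≤ m) {v : ℕ} (hv : v < m + 1) :
    ((D m hm).edges.map fun p => (D m hm).edgeMark v s(p.1, p.2)).sum =
      2 * (D m hm).delta v := by
  obtain ⟨n, rfl⟩ := Nat.exists_eq_add_of_le' hm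
  simp only [edges, List.map_cons, List.map_map, Function.comp_def, edgeMark_mk, List.sum_cons,
    show n + 4 - 2 = n + 2 by omega]
  rw [sum_map_range, Finset.sum_add_distrib]
  rcases v with _ | _ | v
  · simp [delta]
  · simp [delta]
  · have h1 := sum_ite_add_eq (n + 2) 1 (v + 1) fun i => (D (n + 4) hm).delta (i + 2)
    have h2 := sum_ite_add_eq (n + 2) 2 v fun i => (D (n + 4) hm).delta (i + 1)
    rw [h1, h2]
    simp only [delta]
    -- The vertex is `v + 2` and the diagram has `m = n + 4`; the last three cases are the vertices
    -- `m - 2`, `m - 1` and `m`.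
    have hcases : v < n ∨ v = n ∨ v = n + 1 ∨ v = n + 2 := by omega
    rcases hcases with h | h | h | h
    all_goals grind

theorem sum_edgeMark (T : EuclideanDiagram) {v : ℕ} (hv : v < T.card) :
    (T.edges.map fun p => T.edgeMark v s(p.1, p.2)).sum = 2 * T.delta v := by
  cases T with
  | A m => exact sum_edgeMark_A m hv
  | D m hm => exact sum_edgeMark_D m hm hv
  | E6 => simp only [card] at hv; interval_cases v <;> decide
  | E7 => simp only [card] at hv; interval_cases v <;> decide
  | E8 => simp only [card] at hv; interval_cases v <;> decide

theorem connected (T : EuclideanDiagram) (P : ℕ → Prop) (hP : ∀ p ∈ T.edges, P p.1 ↔ P p.2)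
    {v : ℕ} (hv : v < T.card) : P v ↔ P 0 := by
  cases T with
  | A m =>
    simp only [card] at hv
    induction v with
    | zero => rfl
    | succ v ih =>
      have := hP (v, (v + 1) % (m + 1)) (by simp only [edges, List.mem_map]; exact
        ⟨v, by simp; omega, rfl⟩)
      rw [Nat.mod_eq_of_lt hv] at this
      exact this.symm.trans (ih (by omega))
  | D m hm =>
    simp only [card] at hv
    have h0 : P 0 ↔ P 2 := hP (0, 2) (by simp [edges])
    have hm' : P (m - 2) ↔ P m := hP (m - 2, m) (by simp [edges])
    have hstep : ∀ j, j < m - 2 → (P (j + 1) ↔ P (j + 2)) := fun j hj =>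
      hP (j + 1, j + 2) (by
        simp only [edges, List.mem_cons, List.mem_map, List.mem_range]
        exact Or.inr (Or.inr ⟨j, hj, rfl⟩))
    have h1 : P 1 ↔ P 0 := (hstep 0 (by omega)).trans h0.symm
    have hpath : ∀ j, j < m - 1 → (P (j + 1) ↔ P 0) := fun j => by
      induction j with
      | zero => exact fun _ => h1
      | succ j ih => exact fun hj => (hstep j (by omega)).symm.trans (ih (by omega))
    rcases Nat.eq_zero_or_pos v with rfl | hv0
    · rfl
    · rcases Nat.lt_or_ge v m with hvm | hvm
      · have := hpath (v - 1) (by omega)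
        rwa [Nat.sub_add_cancel hv0] at this
      · obtain rfl : v = m := by omega
        have := hpath (v - 3) (by omega)
        rw [show v - 3 + 1 = v - 2 by omega] at this
        exact hm'.symm.trans this
  | E6 =>
    simp only [edges, List.forall_mem_cons] at hP
    simp only [card] at hv
    interval_cases v <;> grind
  | E7 =>
    simp only [edges, List.forall_mem_cons] at hP
    simp only [card] at hv
    interval_cases v <;> grind
  | E8 =>
    simp only [edges, List.forall_mem_cons] at hP
    simp only [card] at hv
    interval_cases v <;> grind

end EuclideanDiagram

namespace FinQuiver

variable {V E : Type} [Fintype V] [DecidableEq V] [Fintype E] {Q : FinQuiver V E}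

theorem HasDiagram.isEuclidean (hQ : Q.NoOrientedCycles) {T : EuclideanDiagram}
    {f : V ≃ Fin T.card} (hf : Q.HasDiagram T f) :
    Q.IsEuclidean fun i => T.delta (f i : ℕ) where
  pos i := T.delta_pos (f i).2
  loopless := hQ.loopless
  neighborSum_eq i := by
    rw [← T.sum_edgeMark (f i).2]
    -- Summing a function of unordered edges over the equal multisets moves the radical equation
    -- from the diagram to `Q`, whatever the orientation.
    have h := congrArg (fun s => (s.map (T.edgeMark (f i))).sum) hf
    simp only [Multiset.map_map, Multiset.map_coe, Multiset.sum_coe, List.map_map] at h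
    refine Eq.trans (Finset.sum_congr rfl fun e _ => ?_) h
    simp only [Function.comp_apply, EuclideanDiagram.edgeMark_mk, Fin.val_inj, f.apply_eq_iff_eq]
  connected P hP i j := by
    have key : ∀ v, P v ↔ P (f.symm ⟨0, lt_of_le_of_lt (Nat.zero_le _) (f i).2⟩) := fun v => by
      have := T.connected (fun n => ∃ h : n < T.card, P (f.symm ⟨n, h⟩)) (fun p hp => ?_)
        (f v).2
      · simpa [(lt_of_le_of_lt (Nat.zero_le _) (f i).2 : 0 < T.card)] using this
      · have hmem : s(p.1, p.2) ∈ (Finset.univ : Finset E).val.map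
            (fun e => s((f (Q.src e) : ℕ), (f (Q.tgt e) : ℕ))) := by
          rw [hf]
          exact Multiset.mem_coe.2 (List.mem_map.2 ⟨p, hp, rfl⟩)
        obtain ⟨e, -, he⟩ := Multiset.mem_map.1 hmem
        have h1 : ∀ w, (∃ h : (f w : ℕ) < T.card, P (f.symm ⟨f w, h⟩)) ↔ P w := fun w => by
          simp
        rcases Sym2.eq_iff.1 he with ⟨h2, h3⟩ | ⟨h2, h3⟩
        · rw [← h2, ← h3, h1, h1]; exact hP e
        · rw [← h2, ← h3, h1, h1]; exact (hP e).symm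
    rw [key i, key j]
    exact id

end FinQuiver

/-! ### The `2n` series and their dimension vectors. -/

namespace QuiverRep

variable {V E : Type} {k : Type u} [Field k] {Q : FinQuiver V E} {δ : V → ℤ}

theorem IsIsomorphic.dimVector_eq {X Y : QuiverRep k Q} (h : X.IsIsomorphic Y) :
    X.dimVector = Y.dimVector := by
  obtain ⟨f⟩ := h
  funext i
  exact congrArg Nat.cast (f.equiv i).finrank_eq

variable [DecidableEq V] [Fintype E]

/-- The dimension vectors of the members of the series. -/
noncomputable def seriesDim (o : Q.AdmissibleOrdering) : V ⊕ V → ℕ → V → ℤ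
  | Sum.inl i, r => (Q.reflectionList o.list.reverse)^[r] fun j => Q.pathMatrix i j
  | Sum.inr i, r => (Q.reflectionList o.list)^[r] fun j => Q.pathMatrix j i

section Series

variable [DecidableEq E]

theorem coxPow_natCast (o : Q.AdmissibleOrdering) (r : ℕ) (X : QuiverRep k Q) :
    coxPow o (r : ℤ) X = (coxPlus o)^[r] X := rfl

theorem coxPow_neg_natCast (o : Q.AdmissibleOrdering) (r : ℕ) (X : QuiverRep k Q) :
    coxPow o (-(r : ℤ)) X = (coxMinus o)^[r] X := by
  cases r <;> rfl

theorem exists_isIsomorphic_series {o : Q.AdmissibleOrdering} {X : QuiverRep k Q}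
    (hX : IsPreprojective o X ∨ IsPreinjective o X) :
    ∃ p r, X.IsIsomorphic (series k o p r) := by
  rcases hX with ⟨-, i, r, hr, h⟩ | ⟨-, i, r, hr, h⟩
  · refine ⟨Sum.inl i, r.natAbs, ?_⟩
    rwa [series, Int.ofNat_natAbs_of_nonpos hr, neg_neg]
  · refine ⟨Sum.inr i, r.natAbs, ?_⟩
    rwa [series, Int.natAbs_of_nonneg hr]

end Series

variable [Fintype V]

theorem isPosRoot_seriesDim (hQ : Q.NoOrientedCycles) (hδ : Q.IsEuclidean δ)
    (o : Q.AdmissibleOrdering) (p : V ⊕ V) (r : ℕ) : Q.IsPosRoot (seriesDim o p r) := by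
  have D := hQ.coxeterDatum hδ o
  cases p with
  | inl i =>
    have := (D.op.isPosRoot_iterate_h i r).1
    rwa [FinQuiver.isPosRoot_op, FinQuiver.reflectionList_op] at this
  | inr i => exact (D.isPosRoot_iterate_h i r).1

theorem defect_seriesDim (hQ : Q.NoOrientedCycles) (hδ : Q.IsEuclidean δ)
    (o : Q.AdmissibleOrdering) (p : V ⊕ V) (r : ℕ) :
    Q.eulerForm δ (seriesDim o p r) = Sum.elim (fun i => -δ i) δ p := by
  have D := hQ.coxeterDatum hδ o
  cases p with
  | inl i =>
    have := D.op.defect_iterate r (fun j => Q.pathMatrix i j)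
    rw [D.op.defect_h, FinQuiver.reflectionList_op, FinQuiver.eulerForm_op,
      hδ.eulerForm_swap] at this
    exact neg_eq_iff_eq_neg.1 this
  | inr i => exact (D.defect_iterate r _).trans (D.defect_h i)

theorem seriesDim_inj (hQ : Q.NoOrientedCycles) (hδ : Q.IsEuclidean δ)
    (o : Q.AdmissibleOrdering) {p p' : V ⊕ V} {r r' : ℕ}
    (h : seriesDim o p r = seriesDim o p' r') : p = p' ∧ r = r' := by
  have D := hQ.coxeterDatum hδ o
  -- The sign of the defect separates the preprojective series from the preinjective ones.
  have hd := congrArg (Q.eulerForm δ) h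
  rw [defect_seriesDim hQ hδ, defect_seriesDim hQ hδ] at hd
  rcases p with i | i <;> rcases p' with j | j <;> simp only [Sum.elim_inl, Sum.elim_inr] at hd
  · have := D.op.iterate_h_inj (i := i) (j := j) (r := r) (s := r')
      (by rw [FinQuiver.reflectionList_op]; exact h)
    exact ⟨congrArg _ this.1, this.2⟩
  · linarith [hδ.pos i, hδ.pos j]
  · linarith [hδ.pos i, hδ.pos j]
  · have := D.iterate_h_inj h
    exact ⟨congrArg _ this.1, this.2⟩

theorem exists_eq_seriesDim (hQ : Q.NoOrientedCycles) (hδ : Q.IsEuclidean δ)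
    (o : Q.AdmissibleOrdering) {x : V → ℤ} (hx : Q.IsPosRoot x) (hd : Q.eulerForm δ x ≠ 0) :
    ∃ p r, x = seriesDim o p r := by
  have D := hQ.coxeterDatum hδ o
  rcases lt_or_gt_of_ne hd with hd | hd
  · obtain ⟨i, r, h⟩ := D.exists_eq_iterate_p hx hd
    exact ⟨Sum.inl i, r, h⟩
  · obtain ⟨i, r, h⟩ := D.op.exists_eq_iterate_p (x := x)
      (by rwa [FinQuiver.isPosRoot_op])
      (by rw [FinQuiver.eulerForm_op, hδ.eulerForm_swap]; linarith)
    rw [FinQuiver.reflectionList_op, List.reverse_reverse] at h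
    exact ⟨Sum.inr i, r, h⟩

variable [DecidableEq E]

theorem isIndecOfDim_series (hQ : Q.NoOrientedCycles) (hδ : Q.IsEuclidean δ)
    (o : Q.AdmissibleOrdering) (p : V ⊕ V) (r : ℕ) :
    (series k o p r).IsIndecOfDim (seriesDim o p r) := by
  have D := hQ.coxeterDatum hδ o
  cases p with
  | inl i =>
    rw [series, coxPow_neg_natCast]
    refine (isIndecOfDim_proj hQ i).iterate_coxMinus (fun r => ?_) r
    have := (D.op.isPosRoot_iterate_h i r).2
    rwa [FinQuiver.avoidsSimple_congr Q.reflection_op, FinQuiver.reflectionList_op] at this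
  | inr i =>
    rw [series, coxPow_natCast]
    exact (isIndecOfDim_inj hQ i).iterate_coxPlus (fun r => (D.isPosRoot_iterate_h i r).2) r

theorem isPreprojective_or_isPreinjective_series (hQ : Q.NoOrientedCycles)
    (hδ : Q.IsEuclidean δ) (o : Q.AdmissibleOrdering) :
    (∀ i r, IsPreprojective o (series k o (Sum.inl i) r)) ∧
      ∀ i r, IsPreinjective o (series k o (Sum.inr i) r) :=
  ⟨fun i r => ⟨(isIndecOfDim_series hQ hδ o _ r).indecomposable, i, -(r : ℤ), by simp,
      isIsomorphic_equivalence.refl _⟩,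
    fun i r => ⟨(isIndecOfDim_series hQ hδ o _ r).indecomposable, i, (r : ℤ), by simp,
      isIsomorphic_equivalence.refl _⟩⟩

end QuiverRep

theorem mainTheorem3 {k : Type u} [Field k] {V E : Type} [Fintype V] [DecidableEq V]
    [Fintype E] [DecidableEq E] (Q : FinQuiver V E) (hQ : Q.NoOrientedCycles)
    (T : EuclideanDiagram) (f : V ≃ Fin T.card) (hf : Q.HasDiagram T f) :
    -- admissible orderings exist, and for each of them the following holds
    Nonempty Q.AdmissibleOrdering ∧
    ∀ o : Q.AdmissibleOrdering,
      -- dimension vectors: a bijection onto the positive roots of non-zero defect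
      Set.BijOn QuiverRep.IsoClass.dimVector (QuiverRep.preprojPreinjClasses k o)
        {x : V → ℤ | Q.IsRoot x ∧ 0 < x ∧ Q.defect T f x ≠ 0} ∧
      -- there are `2n` series, each member of which is finite dimensional and
      -- an indecomposable preprojective, respectively preinjective, representation
      Fintype.card (V ⊕ V) = 2 * T.card ∧
      (∀ (p : V ⊕ V) (r : ℕ), (QuiverRep.series k o p r).IsFiniteDimensional) ∧
      (∀ (i : V) (r : ℕ),
        QuiverRep.IsPreprojective o (QuiverRep.series k o (Sum.inl i) r)) ∧
      (∀ (i : V) (r : ℕ),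
        QuiverRep.IsPreinjective o (QuiverRep.series k o (Sum.inr i) r)) ∧
      -- the members of the series are pairwise non-isomorphic
      (∀ (p p' : V ⊕ V) (r r' : ℕ),
        (QuiverRep.series k o p r).IsIsomorphic (QuiverRep.series k o p' r') →
          p = p' ∧ r = r') ∧
      -- every indecomposable preprojective or preinjective representation occurs
      (∀ X : QuiverRep k Q, QuiverRep.IsPreprojective o X ∨ QuiverRep.IsPreinjective o X →
        ∃ (p : V ⊕ V) (r : ℕ), X.IsIsomorphic (QuiverRep.series k o p r)) := by
  have hδ := hf.isEuclidean hQ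
  refine ⟨hQ.nonempty_admissibleOrdering, fun o => ?_⟩
  have hs := QuiverRep.isIndecOfDim_series (k := k) hQ hδ o
  obtain ⟨hpp, hpi⟩ := QuiverRep.isPreprojective_or_isPreinjective_series (k := k) hQ hδ o
  have hinj : ∀ (p p' : V ⊕ V) (r r' : ℕ), (QuiverRep.series k o p r).dimVector =
      (QuiverRep.series k o p' r').dimVector → p = p' ∧ r = r' := fun p p' r r' h => by
    rw [(hs p r).dimVector_eq, (hs p' r').dimVector_eq] at h
    exact QuiverRep.seriesDim_inj hQ hδ o h
  refine ⟨⟨?_, ?_, ?_⟩, ?_, fun p r => (hs p r).finiteDimensional, hpp, hpi,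
    fun p p' r r' h => hinj p p' r r' h.dimVector_eq,
    fun X hX => QuiverRep.exists_isIsomorphic_series hX⟩
  · rintro _ ⟨X, rfl, -, hX⟩
    obtain ⟨p, r, h⟩ := QuiverRep.exists_isIsomorphic_series hX
    have hdim : X.isoClass.dimVector = QuiverRep.seriesDim o p r :=
      h.dimVector_eq.trans (hs p r).dimVector_eq
    rw [hdim]
    have hroot := QuiverRep.isPosRoot_seriesDim hQ hδ o p r
    refine ⟨hroot.1, hroot.2, ?_⟩
    rw [FinQuiver.defect, QuiverRep.defect_seriesDim hQ hδ]
    rcases p with i | i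
    · exact neg_ne_zero.2 (hδ.pos i).ne'
    · exact (hδ.pos i).ne'
  · rintro _ ⟨X, rfl, -, hX⟩ _ ⟨Y, rfl, -, hY⟩ hXY
    obtain ⟨p, r, h⟩ := QuiverRep.exists_isIsomorphic_series hX
    obtain ⟨p', r', h'⟩ := QuiverRep.exists_isIsomorphic_series hY
    have hXY : X.dimVector = Y.dimVector := hXY
    -- Equal dimension vectors force the same place in the series, so both representations are
    -- isomorphic to one and the same member.
    obtain ⟨rfl, rfl⟩ := hinj p p' r r' (by rw [← h.dimVector_eq, ← h'.dimVector_eq, hXY])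
    exact Quotient.sound (QuiverRep.isIsomorphic_equivalence.trans h
      (QuiverRep.isIsomorphic_equivalence.symm h'))
  · rintro x ⟨hroot, hpos, hd⟩
    obtain ⟨p, r, rfl⟩ := QuiverRep.exists_eq_seriesDim hQ hδ o ⟨hroot, hpos⟩ hd
    refine ⟨(QuiverRep.series k o p r).isoClass,
      ⟨_, rfl, (hs p r).finiteDimensional, ?_⟩, (hs p r).dimVector_eq⟩
    rcases p with i | i
    · exact Or.inl (hpp i r)
    · exact Or.inr (hpi i r)
  · rw [Fintype.card_sum, Fintype.card_congr f, Fintype.card_fin, two_mul]
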